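/- Let $U\subseteq\mathbb R^4$ be an open coordinate domain with coordinates $u=(x^1,x^2,y^1,y^2)$, let $G>0$ and $\lambda\in\mathbb R$. Let $\mathbf e^\alpha=e^\alpha{}_{\underline\mu}du^{\underline\mu}$ be a coframe of class $C^2$ adapted to a nonlinear connection (i.e. $\mathbf e^i=e^i{}_{\underline j}dx^{\underline j}$ and $\mathbf e^a=e^a{}_{\underline j}dx^{\underline j}+e^a{}_{\underline b}dy^{\underline b}$; for instance $\mathbf e^i=dx^i$, $\mathbf e^a=dy^a+N^a_jdx^j$), with dual frame $\mathbf e_\alpha=e_\alpha{}^{\underline\mu}\partial_{\underline\mu}$. Let $\mathbf g=g_{ij}\mathbf e^i\otimes\mathbf e^j+h_{ab}\mathbf e^a\otimes\mathbf e^b$ be a pseudo-Riemannian metric of class $C^2$ and of any signature. Let $\mathbf D$, with connection 1-forms $\Gamma^\alpha{}_\beta$ of class $C^1$, be a metric-compatible d-connection: $\mathbf D\mathbf g=0$, and $\mathbf D$ preserves the horizontal and the vertical distribution. Its torsion is arbitrary (in particular it may be the one induced canonically by $\mathbf g$). Let $\mathcal R^\alpha{}_\beta=d\Gamma^\alpha{}_\beta+\Gamma^\alpha{}_\gamma\wedge\Gamma^\gamma{}_\beta$,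 $\mathcal R^{\beta\gamma}=g^{\gamma\delta}\mathcal R^\beta{}_\delta$, let $\mathbf R_{\beta\gamma}$ be the trace of $X\mapsto R(X,\mathbf e_\gamma)\mathbf e_\beta$, ${}^sR=g^{\beta\gamma}\mathbf R_{\beta\gamma}$, $\mathbf R^{\underline\alpha}{}_\tau=e_\alpha{}^{\underline\alpha}g^{\alpha\beta}\mathbf R_{\beta\tau}$, and let $\epsilon_{\alpha\beta\gamma\delta}=\sqrt{|\det g_{\alpha\beta}|}\,[\alpha\beta\gamma\delta]$ be the absolute antisymmetric tensor, transformed to coordinate indices by the coframe. For a tensor field $T^{\underline\alpha}{}_\tau$ put $\mathcal T_\tau[T]=T^{\underline\alpha}{}_\tau\,\epsilon_{\underline\alpha\underline\beta\underline\gamma\underline\delta}\,du^{\underline\beta}\wedge du^{\underline\gamma}\wedge du^{\underline\delta}$. Let $\nabla$ be the Levi-Civita connection of $\mathbf g$, with connection forms ${}_{|}\Gamma=\Gamma+Z$ and curvature 2-forms ${}_{|}\mathcal R$. Put $\mathcal Z^\alpha{}_\beta=dZ^\alpha{}_\beta+\Gamma^\alpha{}_\gamma\wedge Z^\gamma{}_\beta+Z^\alpha{}_\gamma\wedge\Gamma^\gamma{}_\beta+Z^\alpha{}_\gamma\wedge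 Z^\gamma{}_\beta$, and let ${}^Z T=(8\pi G)^{-1}$ times minus the Einstein contraction (Ricci contraction minus one half of the scalar contraction times $\mathbf e_\tau{}^{\underline\alpha}$) of $\mathcal Z$. Then: 1. For every tensor $T$, at every point of $U$, the equations $\mathbf R^{\underline\alpha}{}_\tau-\tfrac12({}^sR+\lambda)\mathbf e_\tau{}^{\underline\alpha}=8\pi G\,T^{\underline\alpha}{}_\tau$ are equivalent to the 3-form equations $$\epsilon_{\alpha\beta\gamma\tau}\Big(\mathbf e^\alpha\wedge\mathcal R^{\beta\gamma}+\tfrac{\lambda}{6}\,\mathbf e^\alpha\wedge\mathbf e^\beta\wedge\mathbf e^\gamma\Big)=\tfrac{8\pi G}{3}\,\mathcal T_\tau[T].\qquad(*)$$ 2. Let ${}^{gr}S[\mathbf e,\Gamma]=\frac1{16\pi G}\int({}^sR[\mathbf e,\Gamma]+\lambda)\sqrt{|g|}\,d^4u$ (over compact regions of $U$), and let $S'$ be any functional of the coframe whose functional derivative at the given coframe, taken with respect to $\sqrt{|g|}\,d^4u$, is a continuous tensor field: $T^{\underline\alpha}{}_\tau=\delta S'/\delta e^\tau{}_{\underline\alpha}$.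 Then ${}^{gr}S+S'$ is stationary under all smooth compactly supported variations of the components of the coframe, with the frame coefficients $g_{\alpha\beta}$ and the forms $\Gamma^\alpha{}_\beta$ kept fixed (first-order formalism), if and only if $(*)$ holds on $U$. 3. $\mathcal R^\tau{}_\gamma={}_{|}\mathcal R^\tau{}_\gamma-\mathcal Z^\tau{}_\gamma$. The distortion action ${}^ZS=\frac1{16\pi G}\int{}^sR[\mathbf e,\mathcal Z]\sqrt{|g|}\,d^4u$, with $\mathcal Z$ fixed and ${}^sR[\mathbf e,\mathcal Z]$ its scalar contraction, has the functional derivative ${}^Z T$ in the coframe. 4. Let ${}^{m}S[\mathbf e,\Gamma,\phi]$ be a matter action with continuous functional derivative ${}^mT^{\underline\alpha}{}_\tau=\delta\,{}^{m}S/\delta e^\tau{}_{\underline\alpha}$. The effective action ${}^{gr}S+{}^ZS+{}^{m}S$ is stationary under the same variations, with $g_{\alpha\beta}$, $\Gamma$, $Z$ and $\phi$ kept fixed, if and only if $(*)$ holds on $U$ with the source $\mathcal T_\tau={}^m\mathcal T_\tau+{}^Z\mathcal T_\tau$, where ${}^m\mathcal T_\tau=\mathcal T_\tau[{}^mT]$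 and ${}^Z\mathcal T_\tau=\mathcal T_\tau[{}^ZT]$. 5. For every tensor ${}^mT$, at every point of $U$, the equations $(*)$ with the source ${}^m\mathcal T_\tau+{}^Z\mathcal T_\tau$ are equivalent to the usual Einstein equations for $\nabla$: $${}_{|}\mathbf R^{\underline\alpha}{}_\tau-\tfrac12({}_{|}^{s}R+\lambda)\mathbf e_\tau{}^{\underline\alpha}=8\pi G\;{}^mT^{\underline\alpha}{}_\tau .$$ -/

import Mathlib

open scoped ContDiff

noncomputable section

namespace NAnholonomic

/-- Coordinates `u = (x¹, x², y¹, y²)`: the values `0, 1` of an index are horizontal,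
`2, 3` are vertical. -/
abbrev Pt := Fin 4 → ℝ

/-- A coframe field: `E u α μ` is the component `e^α_μ` in `e^α = e^α_μ du^μ`. -/
abbrev Coframe := Pt → Matrix (Fin 4) (Fin 4) ℝ

/-- The coefficients `g_{αβ}` of a metric `g = g_{αβ} e^α ⊗ e^β` in a coframe. -/
abbrev FrameMetric := Pt → Matrix (Fin 4) (Fin 4) ℝ

/-- The connection 1-forms of a linear connection in a frame: `Γ u α β μ` is the coefficient of
`du^μ` in `Γ^α_β`, so that `D_{∂_μ} e_β = Γ^α_{β μ} e_α`. -/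
abbrev ConnForms := Pt → Fin 4 → Fin 4 → Fin 4 → ℝ

/-- The components `C^α_{β μν}` (frame indices `α, β`, coordinate indices `μ, ν`), at a point, of
a matrix of 2-forms. -/
abbrev Curv := Fin 4 → Fin 4 → Fin 4 → Fin 4 → ℝ

/-- Tensor fields `T^μ_τ` with an upper coordinate index `μ` and a lower frame index `τ`. -/
abbrev MixedTensor := Pt → Fin 4 → Fin 4 → ℝ

/-- An action: its value on a compact region `K`, as a functional of the coframe. -/
abbrev Action := Set Pt → Coframe → ℝ

/-- The index is horizontal. -/
def IsHor (α : Fin 4) : Prop := α.val < 2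

/-- Partial derivative `∂f/∂u^μ`. -/
def pd (μ : Fin 4) (f : Pt → ℝ) (u : Pt) : ℝ := fderiv ℝ f u (Pi.single μ 1)

/-- The dual frame: `frame e μ α` is the component `e_α^μ` in `e_α = e_α^μ ∂/∂u^μ`. -/
def frame (e : Matrix (Fin 4) (Fin 4) ℝ) : Matrix (Fin 4) (Fin 4) ℝ := e⁻¹

/-! ### N-adapted geometry -/

/-- `e^α` is a coframe on `U` adapted to a nonlinear connection: `e^i = e^i_j dx^j` and
`e^a = e^a_j dx^j + e^a_b dy^b`. The vertical distribution `{e^i = 0}` is spanned by the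
`∂/∂y^a`, and the horizontal distribution `{e^a = 0}` by the `∂/∂x^i - N^a_i ∂/∂y^a`, where
`e^a_b N^b_i = e^a_i`. The elongated coframe `(dx^i, dy^a + N^a_j dx^j)` is a special case. -/
structure IsAdaptedCoframe (U : Set Pt) (E : Coframe) : Prop where
  contDiffOn : ∀ α μ, ContDiffOn ℝ 2 (fun u => E u α μ) U
  det_ne_zero : ∀ u ∈ U, (E u).det ≠ 0
  adapted : ∀ u ∈ U, ∀ α μ, IsHor α → ¬ IsHor μ → E u α μ = 0

/-- `g = g_{ij} e^i ⊗ e^j + h_{ab} e^a ⊗ e^b` is a pseudo-Riemannian metric, of any signature,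
for which the horizontal and the vertical distributions are orthogonal. -/
structure IsDMetric (U : Set Pt) (g : FrameMetric) : Prop where
  contDiffOn : ∀ α β, ContDiffOn ℝ 2 (fun u => g u α β) U
  symm : ∀ u ∈ U, (g u).IsSymm
  det_ne_zero : ∀ u ∈ U, (g u).det ≠ 0
  block : ∀ u ∈ U, ∀ α β, IsHor α → ¬ IsHor β → g u α β = 0

/-- The connection is a d-connection: parallel transport preserves the horizontal and the vertical
distributions. -/
structure IsDConnection (U : Set Pt) (Γ : ConnForms) : Prop where
  contDiffOn : ∀ α β μ, ContDiffOn ℝ 1 (fun u => Γ u α β μ) U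
  preserves : ∀ u ∈ U, ∀ α β μ, ¬ (IsHor α ↔ IsHor β) → Γ u α β μ = 0

/-- `D g = 0`. -/
def IsMetricCompatible (U : Set Pt) (g : FrameMetric) (Γ : ConnForms) : Prop :=
  ∀ u ∈ U, ∀ α β μ, pd μ (fun v => g v α β) u =
    ∑ γ, (g u γ β * Γ u γ α μ + g u α γ * Γ u γ β μ)

/-! ### Curvature -/

/-- Curvature, `R(∂_μ, ∂_ν) e_β = C^α_{β μν} e_α` with `R(X, Y) = D_X D_Y - D_Y D_X - D_{[X, Y]}`.
These are the components of the 2-forms `dΓ^α_β + Γ^α_γ ∧ Γ^γ_β`. -/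
def curv (Γ : ConnForms) (u : Pt) : Curv := fun α β μ ν =>
  pd μ (fun v => Γ v α β ν) u - pd ν (fun v => Γ v α β μ) u
    + ∑ γ, (Γ u α γ μ * Γ u γ β ν - Γ u α γ ν * Γ u γ β μ)

/-- The distortion of curvature caused by replacing `Γ` by `Γ + Z`: components of the 2-forms
`dZ^α_β + Γ^α_γ ∧ Z^γ_β + Z^α_γ ∧ Γ^γ_β + Z^α_γ ∧ Z^γ_β`. -/
def distCurv (Γ Z : ConnForms) (u : Pt) : Curv := fun α β μ ν =>
  pd μ (fun v => Z v α β ν) u - pd ν (fun v => Z v α β μ) u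
    + ∑ γ, (Γ u α γ μ * Z u γ β ν - Γ u α γ ν * Z u γ β μ)
    + ∑ γ, (Z u α γ μ * Γ u γ β ν - Z u α γ ν * Γ u γ β μ)
    + ∑ γ, (Z u α γ μ * Z u γ β ν - Z u α γ ν * Z u γ β μ)

/-- Ricci contraction in the frame: `R_{βγ}` is the trace of `X ↦ R(X, e_γ) e_β`. -/
def ricci (e : Matrix (Fin 4) (Fin 4) ℝ) (C : Curv) (β γ : Fin 4) : ℝ :=
  ∑ α, ∑ μ, ∑ ν, C α β μ ν * frame e μ α * frame e ν γ

/-- `R^μ_τ = e_α^μ g^{αβ} R_{βτ}`. -/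
def ricciMixed (g e : Matrix (Fin 4) (Fin 4) ℝ) (C : Curv) (μ τ : Fin 4) : ℝ :=
  ∑ α, ∑ β, frame e μ α * g⁻¹ α β * ricci e C β τ

/-- Scalar curvature `g^{αβ} R_{αβ}`. -/
def scalarCurv (g e : Matrix (Fin 4) (Fin 4) ℝ) (C : Curv) : ℝ :=
  ∑ α, ∑ β, g⁻¹ α β * ricci e C α β

/-! ### The Levi-Civita connection -/

/-- Coordinate components of the metric, `g_{μν} = g_{αβ} e^α_μ e^β_ν`. -/
def coordMetric (g : FrameMetric) (E : Coframe) (u : Pt) : Matrix (Fin 4) (Fin 4) ℝ :=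
  (E u).transpose * g u * E u

/-- Christoffel symbols `Γ^ρ_{μν}` of the metric. -/
def christoffel (g : FrameMetric) (E : Coframe) (u : Pt) (ρ μ ν : Fin 4) : ℝ :=
  (1 / 2) * ∑ σ, (coordMetric g E u)⁻¹ ρ σ *
    (pd μ (fun v => coordMetric g E v σ ν) u + pd ν (fun v => coordMetric g E v σ μ) u
      - pd σ (fun v => coordMetric g E v μ ν) u)

/-- Connection 1-forms, in the frame `e_α`, of the Levi-Civita connection:
`∇_{∂_μ} e_β = (∂_μ e_β^ρ + Γ^ρ_{μν} e_β^ν) ∂_ρ`. -/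
def leviCivita (g : FrameMetric) (E : Coframe) : ConnForms := fun u α β μ =>
  ∑ ρ, E u α ρ * (pd μ (fun v => frame (E v) ρ β) u
    + ∑ ν, christoffel g E u ρ μ ν * frame (E u) ν β)

/-- The distortion `Z`, where `Γ` is the Levi-Civita connection minus `Z`. -/
def distortion (g : FrameMetric) (E : Coframe) (Γ : ConnForms) : ConnForms := fun u α β μ =>
  leviCivita g E u α β μ - Γ u α β μ

/-! ### Exterior forms at a point -/

/-- Exterior forms on the tangent space at a point; the product is the wedge product. -/
abbrev Form := ExteriorAlgebra ℝ (Module.Dual ℝ Pt)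

/-- The coordinate 1-form `du^μ`. -/
def du (μ : Fin 4) : Form := ExteriorAlgebra.ι ℝ (LinearMap.proj μ : Module.Dual ℝ Pt)

/-- The 1-form `e^α = e^α_μ du^μ`. -/
def coform (e : Matrix (Fin 4) (Fin 4) ℝ) (α : Fin 4) : Form := ∑ μ, e α μ • du μ

/-- The 2-form `(1/2) C^α_{β μν} du^μ ∧ du^ν`. -/
def twoForm (C : Curv) (α β : Fin 4) : Form :=
  ∑ μ, ∑ ν, ((1 / 2 : ℝ) * C α β μ ν) • (du μ * du ν)

/-- The 2-form with the second index raised, `C^{αβ} = g^{βγ} C^α_γ`. -/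
def twoFormUp (g : Matrix (Fin 4) (Fin 4) ℝ) (C : Curv) (α β : Fin 4) : Form :=
  ∑ γ, g⁻¹ β γ • twoForm C α γ

/-- The permutation symbol, with value `1` at `(0, 1, 2, 3)`. -/
def permSymbol (α β γ δ : Fin 4) : ℝ :=
  Matrix.det (Matrix.of fun i j : Fin 4 => if ![α, β, γ, δ] i = j then (1 : ℝ) else 0)

/-- The absolute antisymmetric tensor `ε_{αβγδ}` in frame indices. -/
def eps (g : Matrix (Fin 4) (Fin 4) ℝ) (α β γ δ : Fin 4) : ℝ :=
  √|g.det| * permSymbol α β γ δ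

/-- The same tensor in coordinate indices. -/
def epsCoord (g e : Matrix (Fin 4) (Fin 4) ℝ) (μ ν ρ σ : Fin 4) : ℝ :=
  ∑ α, ∑ β, ∑ γ, ∑ δ, e α μ * e β ν * e γ ρ * e δ σ * eps g α β γ δ

/-- The 3-form `ε_{αβγτ} (e^α ∧ C^{βγ} + (lam/6) e^α ∧ e^β ∧ e^γ)`. -/
def fieldForm (lam : ℝ) (g e : Matrix (Fin 4) (Fin 4) ℝ) (C : Curv) (τ : Fin 4) : Form :=
  ∑ α, ∑ β, ∑ γ, eps g α β γ τ • (coform e α * twoFormUp g C β γ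
    + (lam / 6) • (coform e α * coform e β * coform e γ))

/-- The source 3-form `T^μ_τ ε_{μνρσ} du^ν ∧ du^ρ ∧ du^σ`. -/
def sourceForm (g e : Matrix (Fin 4) (Fin 4) ℝ) (T : Fin 4 → Fin 4 → ℝ) (τ : Fin 4) : Form :=
  ∑ μ, ∑ ν, ∑ ρ, ∑ σ, (T μ τ * epsCoord g e μ ν ρ σ) • (du ν * du ρ * du σ)

/-! ### Field equations at a point -/

/-- `R^μ_τ - (1/2) (R + lam) e_τ^μ = 8πG T^μ_τ`. -/
def TensorEquation (G lam : ℝ) (g e : Matrix (Fin 4) (Fin 4) ℝ) (C : Curv)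
    (T : Fin 4 → Fin 4 → ℝ) : Prop :=
  ∀ μ τ, ricciMixed g e C μ τ - (1 / 2) * (scalarCurv g e C + lam) * frame e μ τ
    = 8 * Real.pi * G * T μ τ

/-- `ε_{αβγτ} (e^α ∧ C^{βγ} + (lam/6) e^α ∧ e^β ∧ e^γ) = (8πG/3) 𝒯_τ`. -/
def FormEquation (G lam : ℝ) (g e : Matrix (Fin 4) (Fin 4) ℝ) (C : Curv)
    (S : Fin 4 → Form) : Prop :=
  ∀ τ, fieldForm lam g e C τ = (8 * Real.pi * G / 3) • S τ

/-- The tensor `T_Z`: `1/(8πG)` times minus the Einstein contraction of the distortion of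
curvature. -/
def distSource (G : ℝ) (g : FrameMetric) (E : Coframe) (Γ : ConnForms) : MixedTensor :=
  fun u μ τ =>
    let C := distCurv Γ (distortion g E Γ) u
    (8 * Real.pi * G)⁻¹ *
      -(ricciMixed (g u) (E u) C μ τ - (1 / 2) * scalarCurv (g u) (E u) C * frame (E u) μ τ)

/-! ### Actions and their variations in the coframe -/

/-- The volume density `√|det g_{μν}|` of the metric `g_{αβ} e^α ⊗ e^β`. -/
def volDensity (g e : Matrix (Fin 4) (Fin 4) ℝ) : ℝ := √|g.det| * |e.det|

/-- First-order (Palatini) gravitational action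
`(1/16πG) ∫_K (R[e, Γ] + lam) √|g| d⁴u`, as a functional of `e` for given `Γ`. -/
def gravAction (G lam : ℝ) (g : FrameMetric) (Γ : ConnForms) : Action := fun K e =>
  1 / (16 * Real.pi * G) *
    ∫ u in K, (scalarCurv (g u) (e u) (curv Γ u) + lam) * volDensity (g u) (e u)

/-- The contribution `(1/16πG) ∫_K R_Z[e] √|g| d⁴u` of the distortion of curvature, as a functional
of `e` for given `Γ` and `Z`. -/
def distAction (G : ℝ) (g : FrameMetric) (Γ Z : ConnForms) : Action := fun K e =>
  1 / (16 * Real.pi * G) *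
    ∫ u in K, scalarCurv (g u) (e u) (distCurv Γ Z u) * volDensity (g u) (e u)

/-- Smooth variations of the components of the coframe that vanish outside `K`. -/
def IsVariation (K : Set Pt) (δ : Coframe) : Prop :=
  (∀ α μ, ContDiff ℝ ∞ (fun u => δ u α μ)) ∧ ∀ u, u ∉ K → δ u = 0

/-- `T^μ_τ = δS / δe^τ_μ` at the coframe `E` (functional derivative with respect to the volume
density of the metric): `d/dt S[E + t δ] = ∫ T^μ_τ δ^τ_μ √|g| d⁴u` at `t = 0`. -/
def HasFunctionalDeriv (U : Set Pt) (g : FrameMetric) (E : Coframe) (S : Action)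
    (T : MixedTensor) : Prop :=
  ∀ K, IsCompact K → K ⊆ U → ∀ δ, IsVariation K δ →
    HasDerivAt (fun t : ℝ => S K (fun u => E u + t • δ u))
      (∫ u in K, (∑ μ, ∑ τ, T u μ τ * δ u τ μ) * volDensity (g u) (E u)) 0

/-- `S` is stationary at `E` under all compactly supported variations of the coframe. -/
def IsStationary (U : Set Pt) (E : Coframe) (S : Action) : Prop :=
  ∀ K, IsCompact K → K ⊆ U → ∀ δ, IsVariation K δ →
    HasDerivAt (fun t : ℝ => S K (fun u => E u + t • δ u)) 0 0

end NAnholonomic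

end

/-!
The statement is a chain of pointwise identities, plus one differentiation under an integral sign.

*Tensors and 3-forms.* At a point, the four 3-forms `coTriple (coform e) σ` complementary to the
`e^σ` are independent (`coTriple_injective`: multiply by `e^ρ` and evaluate a determinant), and
every product `e^α ∧ e^β ∧ e^γ` is the combination of them with coefficients `[αβγσ]`
(`coform_mul_mul`). Contracting permutation symbols, the left-hand side of the 3-form equations has
coefficients `-2 √|g|` times the Einstein contraction (`fieldForm_eq`), and the source has
coefficients `-6 √|g|` times `T` (`sourceForm_eq`). Their ratio gives
`tensorEquation_iff_formEquation`. The contraction needs `C^{αβ} = -C^{βα}`, which for the curvature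
of a metric-compatible connection is `d(Dg) = 0` (`isAntisymm_curv`).

*Distortion.* Curvature is quadratic in the connection forms, so `curv (Γ + Z)` is `curv Γ` plus
`distCurv Γ Z` (`curv_leviCivita`). The Levi-Civita connection being metric-compatible
(`isMetricCompatible_leviCivita`), the distortion of curvature is antisymmetric as well.

*Variations.* With `C` and `g_{αβ}` fixed, the Lagrangian density depends on the coframe
algebraically, through `e⁻¹` and `|det e|`. From `δ(e⁻¹) = -e⁻¹ δe e⁻¹` and
`δ|det e| = |det e| tr (e⁻¹ δe)`, and since by antisymmetry both frames in the scalar contraction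
contribute equally (`scalarPolar_comm`), its variation is `-2` times the Einstein contraction
(`hasDerivAt_lagrangian`). On a compact region the varied coframe stays invertible for small
parameters, which allows differentiation under the integral (`hasFunctionalDeriv_action`), and the
fundamental lemma of the calculus of variations turns stationarity into pointwise equations
(`isStationary_iff`). Applied to `curv Γ` and to `distCurv Γ Z` this yields the Euler-Lagrange
equations and the functional derivative `T_Z`; linearity of the Einstein contraction in the
curvature moves `T_Z` to the left-hand side and produces the Levi-Civita equations.
-/

noncomputable section

namespace NAnholonomic

open Finset

/-! ### The permutation symbol -/

/-- Twelve times the permutation symbol, as the Vandermonde product of the four indices. -/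
def vandermondeSymbol (α β γ δ : Fin 4) : ℤ :=
  ((β : ℤ) - α) * (γ - α) * (δ - α) * (γ - β) * (δ - β) * (δ - γ)

/-- The Vandermonde matrix of the nodes `α, β, γ, δ` is the permutation matrix times the one of the
nodes `0, 1, 2, 3`, whose determinant is `12`. -/
theorem permSymbol_eq (α β γ δ : Fin 4) :
    permSymbol α β γ δ = (vandermondeSymbol α β γ δ : ℝ) / 12 := by
  have h : (Matrix.vandermonde fun i : Fin 4 => ((![α, β, γ, δ] i : Fin 4) : ℝ)) =
      (Matrix.of fun i j : Fin 4 => if ![α, β, γ, δ] i = j then (1 : ℝ) else 0) *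
        Matrix.vandermonde fun i : Fin 4 => ((i : Fin 4) : ℝ) := by
    ext i j
    simp [Matrix.mul_apply, Matrix.vandermonde_apply]
  have h' := congrArg Matrix.det h
  have e (i : Fin 4) : Finset.Ioi i = Finset.univ.filter (i < ·) := by ext; simp
  rw [Matrix.det_mul, Matrix.det_vandermonde, Matrix.det_vandermonde] at h'
  simp only [e, Finset.prod_filter, Fin.prod_univ_four] at h'
  simp only [Matrix.cons_val] at h'
  norm_num [Fin.lt_def] at h'
  rw [permSymbol, vandermondeSymbol]
  push_cast
  linear_combination h' / (-12 : ℝ)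

/-- Kronecker's symbol with integer values. -/
def kron (α β : Fin 4) : ℤ := if α = β then 1 else 0

/-- The contraction of two permutation symbols over one index is the generalized Kronecker delta
(times `144 = 12 ^ 2`, by the normalization of `vandermondeSymbol`). -/
theorem sum_vandermondeSymbol_mul : ∀ β γ τ κ l σ : Fin 4,
    ∑ α, vandermondeSymbol α β γ τ * vandermondeSymbol α κ l σ = 144 *
      (kron β κ * (kron γ l * kron τ σ - kron γ σ * kron τ l)
        - kron β l * (kron γ κ * kron τ σ - kron γ σ * kron τ κ)
        + kron β σ * (kron γ κ * kron τ l - kron γ l * kron τ κ)) := by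
  decide +kernel

theorem sum_vandermondeSymbol_cycle : ∀ α σ : Fin 4,
    ∑ β, ∑ γ, ∑ δ, vandermondeSymbol α β γ δ * vandermondeSymbol β γ δ σ = -864 * kron α σ := by
  decide +kernel

theorem sum_vandermondeSymbol_same : ∀ τ σ : Fin 4,
    ∑ α, ∑ β, ∑ γ, vandermondeSymbol α β γ τ * vandermondeSymbol α β γ σ = 864 * kron τ σ := by
  decide +kernel

/-! ### Products of three coframe 1-forms -/

/-- For anticommuting `w⁰, …, w³`, the product that complements `w^σ`: it is `± w^α w^β w^γ` with
`α < β < γ` the indices different from `σ`, the sign being `[αβγσ]`. -/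
def coTriple {A : Type*} [Ring A] (w : Fin 4 → A) : Fin 4 → A :=
  ![-(w 1 * w 2 * w 3), w 0 * w 2 * w 3, -(w 0 * w 1 * w 3), w 0 * w 1 * w 2]

theorem mul_mul_eq_sum_coTriple {A : Type*} [Ring A] [Algebra ℝ A] {w : Fin 4 → A}
    (h0 : ∀ α, w α * w α = 0) (hc : ∀ α β, w α * w β = -(w β * w α)) (α β γ : Fin 4) :
    w α * w β * w γ = ∑ σ, permSymbol α β γ σ • coTriple w σ := by
  have z (α : Fin 4) (x : A) : w α * (w α * x) = 0 := by rw [← mul_assoc, h0, zero_mul]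
  have a (α β : Fin 4) (x : A) : w α * (w β * x) = -(w β * (w α * x)) := by
    rw [← mul_assoc, hc, neg_mul, mul_assoc]
  -- only the instances that sort the factors, so that rewriting with them terminates
  have h10 := hc 1 0
  have h20 := hc 2 0
  have h30 := hc 3 0
  have h21 := hc 2 1
  have h31 := hc 3 1
  have h32 := hc 3 2
  have a10 := a 1 0
  have a20 := a 2 0
  have a30 := a 3 0
  have a21 := a 2 1
  have a31 := a 3 1
  have a32 := a 3 2
  simp only [permSymbol_eq, vandermondeSymbol, Fin.sum_univ_four, coTriple, mul_assoc]
  fin_cases α <;> fin_cases β <;> fin_cases γ <;>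
    simp [h0, h10, h20, h30, h21, h31, h32, z, a10, a20, a30, a21, a31, a32]

/-- The covector `e^α_μ du^μ`. -/
def covector (e : Matrix (Fin 4) (Fin 4) ℝ) (α : Fin 4) : Module.Dual ℝ Pt :=
  ∑ μ, e α μ • (LinearMap.proj μ : Module.Dual ℝ Pt)

theorem coform_eq_ι (e : Matrix (Fin 4) (Fin 4) ℝ) (α : Fin 4) :
    coform e α = ExteriorAlgebra.ι ℝ (covector e α) := by
  simp [coform, du, covector, map_sum]

theorem coform_mul_self (e : Matrix (Fin 4) (Fin 4) ℝ) (α : Fin 4) :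
    coform e α * coform e α = 0 := by
  rw [coform_eq_ι, ExteriorAlgebra.ι_sq_zero]

theorem coform_mul_comm (e : Matrix (Fin 4) (Fin 4) ℝ) (α β : Fin 4) :
    coform e α * coform e β = -(coform e β * coform e α) := by
  rw [coform_eq_ι, coform_eq_ι, eq_neg_iff_add_eq_zero]
  exact ExteriorAlgebra.ι_add_mul_swap _ _

theorem coform_mul_mul (e : Matrix (Fin 4) (Fin 4) ℝ) (α β γ : Fin 4) :
    coform e α * coform e β * coform e γ = ∑ σ, permSymbol α β γ σ • coTriple (coform e) σ :=
  mul_mul_eq_sum_coTriple (coform_mul_self e) (coform_mul_comm e) α β γ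

/-- The determinant of the components of four covectors. -/
def covectorDet : (Module.Dual ℝ Pt) [⋀^Fin 4]→ₗ[ℝ] ℝ :=
  (Matrix.detRowAlternating (n := Fin 4) (R := ℝ)).compLinearMap
    (LinearMap.pi fun j => Module.Dual.eval ℝ Pt (Pi.single j 1))

theorem covectorDet_apply (v : Fin 4 → Module.Dual ℝ Pt) :
    covectorDet v = (Matrix.of fun i j => v i (Pi.single j 1)).det := rfl

/-- The determinant as a linear functional on exterior forms, concentrated in degree four. -/
def volForm : Form →ₗ[ℝ] ℝ :=
  ExteriorAlgebra.liftAlternating (Pi.single 4 covectorDet)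

theorem volForm_ιMulti (v : Fin 4 → Module.Dual ℝ Pt) :
    volForm (ExteriorAlgebra.ιMulti ℝ 4 v) = (Matrix.of fun i j => v i (Pi.single j 1)).det := by
  rw [volForm, ExteriorAlgebra.liftAlternating_apply_ιMulti, Pi.single_eq_same, covectorDet_apply]

theorem volForm_coform (e : Matrix (Fin 4) (Fin 4) ℝ) (α β γ δ : Fin 4) :
    volForm (coform e α * (coform e β * coform e γ * coform e δ)) =
      (e.submatrix ![α, β, γ, δ] id).det := by
  have h : coform e α * (coform e β * coform e γ * coform e δ) =
      ExteriorAlgebra.ιMulti ℝ 4 fun i => covector e (![α, β, γ, δ] i) := by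
    rw [ExteriorAlgebra.ιMulti_apply]
    simp [coform_eq_ι, mul_assoc, List.ofFn_succ]
  rw [h, volForm_ιMulti]
  congr 1
  ext i j
  simp [Pi.single_apply, covector]

theorem volForm_coform_eq (e : Matrix (Fin 4) (Fin 4) ℝ) (α β γ δ : Fin 4) :
    volForm (coform e α * (coform e β * coform e γ * coform e δ)) =
      permSymbol α β γ δ * e.det := by
  rw [volForm_coform, permSymbol, ← Matrix.det_mul]
  congr 1
  ext i j
  simp [Matrix.mul_apply]

/-- The complementary 3-forms are linearly independent: `e^ρ ∧ coTriple σ` is a nonzero 4-form if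
`ρ = σ`, and zero otherwise. -/
theorem coTriple_injective {e : Matrix (Fin 4) (Fin 4) ℝ} (he : e.det ≠ 0)
    {x y : Fin 4 → ℝ}
    (h : ∑ σ, x σ • coTriple (coform e) σ = ∑ σ, y σ • coTriple (coform e) σ) : x = y := by
  ext ρ
  have h1 := congrArg (fun ξ => volForm (coform e ρ * ξ)) h
  simp only [Fin.sum_univ_four, coTriple, mul_add, map_add, Matrix.cons_val, mul_smul_comm,
    map_smul, mul_neg, map_neg, volForm_coform_eq, permSymbol_eq, vandermondeSymbol,
    smul_eq_mul] at h1
  apply mul_right_cancel₀ he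
  fin_cases ρ <;> norm_num at h1 ⊢ <;> simpa [he] using h1

/-! ### Tensor equations and 3-form equations -/

/-- The frame components `C^{αβ}_{κλ}` of a matrix of 2-forms, with the second index raised. -/
def upCurv (g e : Matrix (Fin 4) (Fin 4) ℝ) (C : Curv) : Curv := fun α β κ l =>
  ∑ γ, g⁻¹ β γ * ∑ μ, ∑ ν, C α γ μ ν * frame e μ κ * frame e ν l

/-- The Einstein contraction `R^μ_τ - (1/2) (R + lam) e_τ^μ`. -/
def einstein (lam : ℝ) (g e : Matrix (Fin 4) (Fin 4) ℝ) (C : Curv) (μ τ : Fin 4) : ℝ :=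
  ricciMixed g e C μ τ - (1 / 2) * (scalarCurv g e C + lam) * frame e μ τ

/-- The components `C^α_β` are antisymmetric as 2-forms, and `C^{αβ} = -C^{βα}`. -/
structure IsAntisymm (g : Matrix (Fin 4) (Fin 4) ℝ) (C : Curv) : Prop where
  form : ∀ α β μ ν, C α β μ ν = -C α β ν μ
  up : ∀ α β μ ν, ∑ γ, g⁻¹ β γ * C α γ μ ν = -∑ γ, g⁻¹ α γ * C β γ μ ν

theorem sum_coframe_mul_frame {e : Matrix (Fin 4) (Fin 4) ℝ} (he : e.det ≠ 0) (α β : Fin 4) :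
    ∑ μ, e α μ * frame e μ β = if α = β then 1 else 0 := by
  rw [← Matrix.one_apply, ← Matrix.mul_nonsing_inv e he.isUnit, Matrix.mul_apply]; rfl

theorem sum_frame_mul_coframe {e : Matrix (Fin 4) (Fin 4) ℝ} (he : e.det ≠ 0) (μ ν : Fin 4) :
    ∑ α, frame e μ α * e α ν = if μ = ν then 1 else 0 := by
  rw [← Matrix.one_apply, ← Matrix.nonsing_inv_mul e he.isUnit, Matrix.mul_apply]; rfl

theorem du_eq_sum_coform {e : Matrix (Fin 4) (Fin 4) ℝ} (he : e.det ≠ 0) (μ : Fin 4) :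
    du μ = ∑ α, frame e μ α • coform e α := by
  simp only [coform, smul_sum, smul_smul]
  rw [sum_comm]
  simp [← sum_smul, sum_frame_mul_coframe he]

theorem sum_comm_pairs {M : Type*} [AddCommMonoid M] (f : Fin 4 → Fin 4 → Fin 4 → Fin 4 → M) :
    ∑ α, ∑ β, ∑ γ, ∑ δ, f α β γ δ = ∑ γ, ∑ δ, ∑ α, ∑ β, f α β γ δ := by
  calc ∑ α, ∑ β, ∑ γ, ∑ δ, f α β γ δ
      = ∑ α, ∑ γ, ∑ β, ∑ δ, f α β γ δ := sum_congr rfl fun _ _ => sum_comm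
    _ = ∑ γ, ∑ α, ∑ β, ∑ δ, f α β γ δ := sum_comm
    _ = ∑ γ, ∑ α, ∑ δ, ∑ β, f α β γ δ :=
        sum_congr rfl fun _ _ => sum_congr rfl fun _ _ => sum_comm
    _ = ∑ γ, ∑ δ, ∑ α, ∑ β, f α β γ δ := sum_congr rfl fun _ _ => sum_comm

theorem sum_comm_triple {M : Type*} [AddCommMonoid M] (f : Fin 4 → Fin 4 → Fin 4 → Fin 4 → M) :
    ∑ α, ∑ β, ∑ γ, ∑ δ, f α β γ δ = ∑ δ, ∑ α, ∑ β, ∑ γ, f α β γ δ := by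
  calc ∑ α, ∑ β, ∑ γ, ∑ δ, f α β γ δ
      = ∑ α, ∑ β, ∑ δ, ∑ γ, f α β γ δ :=
        sum_congr rfl fun _ _ => sum_congr rfl fun _ _ => sum_comm
    _ = ∑ α, ∑ δ, ∑ β, ∑ γ, f α β γ δ := sum_congr rfl fun _ _ => sum_comm
    _ = ∑ δ, ∑ α, ∑ β, ∑ γ, f α β γ δ := sum_comm

theorem twoFormUp_eq {g e : Matrix (Fin 4) (Fin 4) ℝ} (he : e.det ≠ 0) (C : Curv) (α β : Fin 4) :
    twoFormUp g C α β =
      ∑ κ, ∑ l, (1 / 2 * upCurv g e C α β κ l) • (coform e κ * coform e l) := by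
  have h (γ : Fin 4) : twoForm C α γ = ∑ κ, ∑ l,
      (1 / 2 * ∑ μ, ∑ ν, C α γ μ ν * frame e μ κ * frame e ν l) • (coform e κ * coform e l) := by
    have h1 (μ ν : Fin 4) : ((1 / 2 : ℝ) * C α γ μ ν) • (du μ * du ν) = ∑ κ, ∑ l,
        (1 / 2 * (C α γ μ ν * frame e μ κ * frame e ν l)) • (coform e κ * coform e l) := by
      rw [du_eq_sum_coform he μ, du_eq_sum_coform he ν, sum_mul_sum, smul_sum]
      refine sum_congr rfl fun κ _ => ?_
      rw [smul_sum]
      refine sum_congr rfl fun l _ => ?_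
      rw [smul_mul_smul_comm, smul_smul]
      congr 1
      ring
    simp only [twoForm, h1, mul_sum, sum_smul]
    rw [sum_comm_pairs]
  simp only [twoFormUp, h, smul_sum, smul_smul]
  rw [sum_comm]
  refine sum_congr rfl fun κ _ => ?_
  rw [sum_comm]
  refine sum_congr rfl fun l _ => ?_
  rw [← sum_smul, upCurv, mul_sum]
  exact congrArg (· • _) (sum_congr rfl fun γ _ => by ring)

theorem upCurv_swap_form {g : Matrix (Fin 4) (Fin 4) ℝ} {C : Curv} (h : IsAntisymm g C)
    (e : Matrix (Fin 4) (Fin 4) ℝ) (α β κ l : Fin 4) :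
    upCurv g e C α β l κ = -upCurv g e C α β κ l := by
  simp only [upCurv, ← sum_neg_distrib, ← mul_neg]
  refine sum_congr rfl fun γ _ => congrArg _ ?_
  rw [sum_comm]
  refine sum_congr rfl fun μ _ => sum_congr rfl fun ν _ => ?_
  rw [h.form α γ ν μ]; ring

theorem upCurv_eq (g e : Matrix (Fin 4) (Fin 4) ℝ) (C : Curv) (α β κ l : Fin 4) :
    upCurv g e C α β κ l =
      ∑ μ, ∑ ν, (∑ γ, g⁻¹ β γ * C α γ μ ν) * frame e μ κ * frame e ν l := by
  simp only [upCurv, mul_sum, sum_mul]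
  rw [sum_comm]
  refine sum_congr rfl fun μ _ => ?_
  rw [sum_comm]
  exact sum_congr rfl fun ν _ => sum_congr rfl fun γ _ => by ring

theorem upCurv_swap_up {g : Matrix (Fin 4) (Fin 4) ℝ} {C : Curv} (h : IsAntisymm g C)
    (e : Matrix (Fin 4) (Fin 4) ℝ) (α β κ l : Fin 4) :
    upCurv g e C β α κ l = -upCurv g e C α β κ l := by
  rw [upCurv_eq, upCurv_eq]
  simp only [h.up β α, neg_mul, sum_neg_distrib]

theorem sum_coframe_mul_sum_frame {e : Matrix (Fin 4) (Fin 4) ℝ} (he : e.det ≠ 0)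
    (v : Fin 4 → ℝ) (σ : Fin 4) : ∑ μ, e σ μ * ∑ α, frame e μ α * v α = v σ := by
  simp only [mul_sum]
  rw [sum_comm]
  simp only [← mul_assoc, ← sum_mul, sum_coframe_mul_frame he]
  simp

theorem sum_coframe_mul_ricciMixed {g e : Matrix (Fin 4) (Fin 4) ℝ} (he : e.det ≠ 0) (C : Curv)
    (σ τ : Fin 4) : ∑ μ, e σ μ * ricciMixed g e C μ τ = ∑ κ, upCurv g e C κ σ κ τ := by
  have h (μ : Fin 4) : ricciMixed g e C μ τ = ∑ α, frame e μ α * ∑ β, g⁻¹ α β * ricci e C β τ := by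
    simp only [ricciMixed, mul_sum, mul_assoc]
  simp only [h, sum_coframe_mul_sum_frame he fun α => ∑ β, g⁻¹ α β * ricci e C β τ]
  simp only [ricci, upCurv]
  rw [sum_comm]
  simp only [mul_sum]

theorem scalarCurv_eq {g : Matrix (Fin 4) (Fin 4) ℝ} (hg : g.IsSymm)
    (e : Matrix (Fin 4) (Fin 4) ℝ) (C : Curv) :
    scalarCurv g e C = ∑ κ, ∑ σ, upCurv g e C κ σ κ σ := by
  have hs : (g⁻¹).IsSymm := by rw [Matrix.IsSymm, Matrix.transpose_nonsing_inv, hg.eq]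
  simp only [scalarCurv, ricci, upCurv]
  rw [sum_comm]
  simp only [mul_sum (s := univ) (f := fun κ => ∑ μ, ∑ ν, C κ _ μ ν * frame e μ κ * frame e ν _)]
  rw [sum_comm_cycle]
  refine sum_congr rfl fun κ _ => sum_congr rfl fun σ _ => sum_congr rfl fun γ _ => ?_
  rw [hs.apply]

/-- The generalized Kronecker delta turns `ε_{αβγτ} e^α ∧ C^{βγ}` into the Einstein contraction. -/
theorem sum_permSymbol_mul_upCurv {g : Matrix (Fin 4) (Fin 4) ℝ} (hg : g.IsSymm) {C : Curv}
    (h : IsAntisymm g C) (e : Matrix (Fin 4) (Fin 4) ℝ) (τ σ : Fin 4) :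
    ∑ β, ∑ γ, ∑ κ, ∑ l, (∑ α, permSymbol α β γ τ * permSymbol α κ l σ) *
      (1 / 2 * upCurv g e C β γ κ l) =
    (if τ = σ then scalarCurv g e C else 0) - 2 * ∑ κ, upCurv g e C κ σ κ τ := by
  have hk (β γ κ l : Fin 4) : ∑ α, permSymbol α β γ τ * permSymbol α κ l σ =
      ((kron β κ * (kron γ l * kron τ σ - kron γ σ * kron τ l)
        - kron β l * (kron γ κ * kron τ σ - kron γ σ * kron τ κ)
        + kron β σ * (kron γ κ * kron τ l - kron γ l * kron τ κ) : ℤ) : ℝ) := by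
    have := congrArg (Int.cast (R := ℝ)) (sum_vandermondeSymbol_mul β γ τ κ l σ)
    rw [Int.cast_mul (144 : ℤ)] at this
    simp only [permSymbol_eq, div_mul_div_comm, ← sum_div]
    rw [div_eq_iff (by norm_num), mul_comm]
    push_cast at this ⊢
    linear_combination this
  simp only [hk, kron]
  simp [add_mul, sub_mul, mul_sub, sum_add_distrib, sum_sub_distrib]
  rw [scalarCurv_eq hg]
  have h1 (x : Fin 4) : upCurv g e C x σ τ x = -upCurv g e C x σ x τ := upCurv_swap_form h ..
  have h2 (x : Fin 4) : upCurv g e C σ x x τ = -upCurv g e C x σ x τ := upCurv_swap_up h ..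
  have h3 (x : Fin 4) : upCurv g e C σ x τ x = upCurv g e C x σ x τ := by
    rw [upCurv_swap_up h, h1, neg_neg]
  have h4 (x y : Fin 4) : upCurv g e C x y y x = -upCurv g e C x y x y := upCurv_swap_form h ..
  simp only [h1, h2, h3, h4, mul_neg, sum_neg_distrib, ← mul_sum]
  split_ifs <;> ring

/-- The coefficients of the field 3-form in the complementary 3-forms are `-2 √|g|` times the
Einstein contraction, with its upper index in the frame. -/
theorem fieldForm_eq {g e : Matrix (Fin 4) (Fin 4) ℝ} (hg : g.IsSymm) (he : e.det ≠ 0) {C : Curv}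
    (h : IsAntisymm g C) (lam : ℝ) (τ : Fin 4) :
    fieldForm lam g e C τ =
      ∑ σ, (-2 * √|g.det| * ∑ μ, e σ μ * einstein lam g e C μ τ) • coTriple (coform e) σ := by
  have h1 (α β γ : Fin 4) : coform e α * twoFormUp g C β γ = ∑ σ,
      (∑ κ, ∑ l, permSymbol α κ l σ * (1 / 2 * upCurv g e C β γ κ l)) •
        coTriple (coform e) σ := by
    simp only [twoFormUp_eq he, mul_sum, mul_smul_comm, ← mul_assoc, coform_mul_mul, smul_sum,
      smul_smul, sum_smul]
    rw [sum_comm_cycle]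
    refine sum_congr rfl fun σ _ => sum_congr rfl fun κ _ => sum_congr rfl fun l _ => ?_
    rw [mul_comm, mul_assoc]
  have h2 (σ : Fin 4) : ∑ α, ∑ β, ∑ γ, permSymbol α β γ τ *
      ((∑ κ, ∑ l, permSymbol α κ l σ * (1 / 2 * upCurv g e C β γ κ l)) +
        lam / 6 * permSymbol α β γ σ) = -2 * ∑ μ, e σ μ * einstein lam g e C μ τ := by
    have h3 : ∑ α, ∑ β, ∑ γ, permSymbol α β γ τ * permSymbol α β γ σ =
        if τ = σ then 6 else 0 := by
      have := congrArg (Int.cast (R := ℝ)) (sum_vandermondeSymbol_same τ σ)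
      simp only [permSymbol_eq, div_mul_div_comm, ← sum_div]
      rw [div_eq_iff (by norm_num)]
      simp only [kron] at this
      push_cast at this
      rw [this]
      split_ifs <;> norm_num
    have h4 := sum_permSymbol_mul_upCurv hg h e τ σ
    have h5 : ∑ μ, e σ μ * einstein lam g e C μ τ = (∑ κ, upCurv g e C κ σ κ τ) -
        (1 / 2) * (scalarCurv g e C + lam) * if τ = σ then 1 else 0 := by
      simp only [einstein, mul_sub, sum_sub_distrib, sum_coframe_mul_ricciMixed he]
      simp only [eq_comm (a := τ)]
      rw [← sum_coframe_mul_frame he, mul_sum]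
      exact congrArg _ (sum_congr rfl fun μ _ => by ring)
    have h6 : ∑ α, ∑ β, ∑ γ, permSymbol α β γ τ *
        (∑ κ, ∑ l, permSymbol α κ l σ * (1 / 2 * upCurv g e C β γ κ l)) =
        ∑ β, ∑ γ, ∑ κ, ∑ l, (∑ α, permSymbol α β γ τ * permSymbol α κ l σ) *
          (1 / 2 * upCurv g e C β γ κ l) := by
      simp only [mul_sum, sum_mul]
      rw [sum_comm]
      refine sum_congr rfl fun β _ => ?_
      rw [sum_comm]
      refine sum_congr rfl fun γ _ => ?_
      rw [sum_comm]
      refine sum_congr rfl fun κ _ => ?_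
      rw [sum_comm]
      exact sum_congr rfl fun l _ => sum_congr rfl fun α _ => (mul_assoc _ _ _).symm
    simp only [mul_add, sum_add_distrib, mul_left_comm _ (lam / 6), ← mul_sum]
    rw [h6, h4, h3, h5]
    split_ifs <;> ring
  simp only [fieldForm, h1, coform_mul_mul, eps, smul_sum, smul_smul, ← sum_add_distrib,
    ← add_smul]
  rw [sum_comm_triple]
  refine sum_congr rfl fun σ _ => ?_
  simp only [← sum_smul]
  congr 1
  rw [mul_right_comm, ← h2 σ, mul_comm]
  simp only [mul_sum (s := univ) (a := √|g.det|)]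
  exact sum_congr rfl fun α _ => sum_congr rfl fun β _ => sum_congr rfl fun γ _ => by ring

theorem sum_epsCoord_smul (g e : Matrix (Fin 4) (Fin 4) ℝ) (μ : Fin 4) :
    ∑ ν, ∑ ρ, ∑ σ, epsCoord g e μ ν ρ σ • (du ν * du ρ * du σ) =
      ∑ α, ∑ β, ∑ γ, ∑ δ, (e α μ * eps g α β γ δ) • (coform e β * coform e γ * coform e δ) := by
  have h (β γ δ : Fin 4) : coform e β * coform e γ * coform e δ =
      ∑ ν, ∑ ρ, ∑ σ, (e β ν * e γ ρ * e δ σ) • (du ν * du ρ * du σ) := by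
    simp only [coform, sum_mul_sum, smul_mul_smul_comm]
    simp only [sum_mul, smul_mul_smul_comm]
    exact sum_congr rfl fun ν _ => sum_comm
  simp only [h, smul_sum, epsCoord, sum_smul, smul_smul]
  rw [sum_comm_triple]
  refine sum_congr rfl fun α _ => ?_
  rw [sum_comm_triple]
  refine sum_congr rfl fun β _ => ?_
  rw [sum_comm_triple]
  refine sum_congr rfl fun γ _ => ?_
  rw [sum_comm_triple]
  refine sum_congr rfl fun δ _ => sum_congr rfl fun ν _ => sum_congr rfl fun ρ _ =>
    sum_congr rfl fun σ _ => ?_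
  congr 1
  ring

/-- The factor `-6` combines `3!` with the sign of moving the first index of `ε` past three others.
-/
theorem sourceForm_eq (g e : Matrix (Fin 4) (Fin 4) ℝ) (T : Fin 4 → Fin 4 → ℝ) (τ : Fin 4) :
    sourceForm g e T τ =
      ∑ σ, (-6 * √|g.det| * ∑ μ, e σ μ * T μ τ) • coTriple (coform e) σ := by
  have h3 (α σ : Fin 4) : ∑ β, ∑ γ, ∑ δ, permSymbol α β γ δ * permSymbol β γ δ σ =
      if α = σ then -6 else 0 := by
    have := congrArg (Int.cast (R := ℝ)) (sum_vandermondeSymbol_cycle α σ)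
    simp only [permSymbol_eq, div_mul_div_comm, ← sum_div]
    rw [div_eq_iff (by norm_num)]
    simp only [kron] at this
    push_cast at this
    rw [this]
    split_ifs <;> norm_num
  have h4 (α : Fin 4) : ∑ β, ∑ γ, ∑ δ, eps g α β γ δ • (coform e β * coform e γ * coform e δ) =
      (-6 * √|g.det|) • coTriple (coform e) α := by
    simp only [coform_mul_mul, smul_sum, smul_smul, eps]
    rw [sum_comm_triple]
    simp only [← sum_smul, mul_assoc, ← mul_sum, h3]
    simp [mul_comm]
  have h5 (μ : Fin 4) : ∑ ν, ∑ ρ, ∑ σ, (T μ τ * epsCoord g e μ ν ρ σ) • (du ν * du ρ * du σ) =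
      ∑ α, (-6 * √|g.det| * (e α μ * T μ τ)) • coTriple (coform e) α := by
    simp only [mul_smul, ← smul_sum, sum_epsCoord_smul, h4]
    simp only [smul_sum, smul_smul]
    refine sum_congr rfl fun α _ => ?_
    congr 1
    ring
  simp only [sourceForm, h5]
  rw [sum_comm]
  simp only [← sum_smul, mul_sum]

theorem coframe_injective {e : Matrix (Fin 4) (Fin 4) ℝ} (he : e.det ≠ 0) {x y : Fin 4 → ℝ}
    (h : ∀ σ, ∑ μ, e σ μ * x μ = ∑ μ, e σ μ * y μ) : x = y := by
  have : e.mulVec x = e.mulVec y := funext h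
  exact Matrix.mulVec_injective_of_isUnit ((Matrix.isUnit_iff_isUnit_det e).2 he.isUnit) this

/-- Both sides of the 3-form equations are expanded in the complementary 3-forms, whose
coefficients are those of the tensor equations up to the factor `-2 √|g| ≠ 0` and the coframe. -/
theorem tensorEquation_iff_formEquation {G lam : ℝ} {g e : Matrix (Fin 4) (Fin 4) ℝ}
    (hg : g.IsSymm) (hg0 : g.det ≠ 0) (he : e.det ≠ 0) {C : Curv} (h : IsAntisymm g C)
    (T : Fin 4 → Fin 4 → ℝ) :
    TensorEquation G lam g e C T ↔ FormEquation G lam g e C (sourceForm g e T) := by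
  have hs : √|g.det| ≠ 0 := (Real.sqrt_pos.2 (abs_pos.2 hg0)).ne'
  have key (τ : Fin 4) : (8 * Real.pi * G / 3) • sourceForm g e T τ = ∑ σ, (-2 * √|g.det| *
      ∑ μ, e σ μ * (8 * Real.pi * G * T μ τ)) • coTriple (coform e) σ := by
    rw [sourceForm_eq, smul_sum]
    refine sum_congr rfl fun σ _ => ?_
    rw [smul_smul, mul_sum, mul_sum, mul_sum]
    exact congrArg (· • _) (sum_congr rfl fun μ _ => by ring)
  constructor
  · intro hT τ
    rw [fieldForm_eq hg he h, key]
    simp only [← hT _ τ, einstein]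
  · intro hF μ τ
    have h1 := hF τ
    rw [fieldForm_eq hg he h, key] at h1
    have h2 := coTriple_injective he h1
    exact congrFun (coframe_injective he (x := fun μ => einstein lam g e C μ τ)
      (y := fun μ => 8 * Real.pi * G * T μ τ)
      fun σ => mul_left_cancel₀ (mul_ne_zero (by norm_num) hs) (congrFun h2 σ)) μ

theorem sourceForm_add (g e : Matrix (Fin 4) (Fin 4) ℝ) (S T : Fin 4 → Fin 4 → ℝ) (τ : Fin 4) :
    sourceForm g e (fun μ τ => S μ τ + T μ τ) τ = sourceForm g e S τ + sourceForm g e T τ := by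
  simp only [sourceForm, add_mul, add_smul, sum_add_distrib]

/-- The Einstein contraction is affine in the curvature: the constant `lam` is counted once. -/
theorem einstein_add (lam : ℝ) (g e : Matrix (Fin 4) (Fin 4) ℝ) (C D : Curv) (μ τ : Fin 4) :
    einstein lam g e (fun α β μ ν => C α β μ ν + D α β μ ν) μ τ =
      einstein lam g e C μ τ + einstein 0 g e D μ τ := by
  simp only [einstein, ricciMixed, scalarCurv, ricci, add_mul, mul_add, sum_add_distrib]
  ring

open Filter Topology

/-! ### Calculus of partial derivatives -/

theorem pd_congr {f h : Pt → ℝ} {u : Pt} (hfh : f =ᶠ[𝓝 u] h) (μ : Fin 4) : pd μ f u = pd μ h u := by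
  rw [pd, pd, hfh.fderiv_eq]

theorem pd_add {f h : Pt → ℝ} {u : Pt} (hf : DifferentiableAt ℝ f u) (hh : DifferentiableAt ℝ h u)
    (μ : Fin 4) : pd μ (fun v => f v + h v) u = pd μ f u + pd μ h u := by
  simp only [pd]; rw [fderiv_fun_add hf hh]; rfl

theorem pd_sub {f h : Pt → ℝ} {u : Pt} (hf : DifferentiableAt ℝ f u) (hh : DifferentiableAt ℝ h u)
    (μ : Fin 4) : pd μ (fun v => f v - h v) u = pd μ f u - pd μ h u := by
  simp only [pd]; rw [fderiv_fun_sub hf hh]; rfl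

theorem pd_mul {f h : Pt → ℝ} {u : Pt} (hf : DifferentiableAt ℝ f u) (hh : DifferentiableAt ℝ h u)
    (μ : Fin 4) : pd μ (fun v => f v * h v) u = pd μ f u * h u + f u * pd μ h u := by
  simp only [pd]; rw [fderiv_fun_mul hf hh]; simp; ring

theorem pd_sum {f : Fin 4 → Pt → ℝ} {u : Pt} (hf : ∀ i, DifferentiableAt ℝ (f i) u) (μ : Fin 4) :
    pd μ (fun v => ∑ i, f i v) u = ∑ i, pd μ (f i) u := by
  simp only [pd]; rw [fderiv_fun_sum fun i _ => hf i]; simp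

theorem contDiffOn_pd {U : Set Pt} (hU : IsOpen U) {m n : WithTop ℕ∞} {f : Pt → ℝ}
    (hf : ContDiffOn ℝ n f U) (hmn : m + 1 ≤ n) (μ : Fin 4) : ContDiffOn ℝ m (pd μ f) U :=
  (hf.fderiv_of_isOpen hU hmn).clm_apply contDiffOn_const

theorem pd_pd_comm {U : Set Pt} (hU : IsOpen U) {f : Pt → ℝ} (hf : ContDiffOn ℝ 2 f U) {u : Pt}
    (hu : u ∈ U) (μ ν : Fin 4) : pd μ (pd ν f) u = pd ν (pd μ f) u := by
  have hf2 : ContDiffAt ℝ 2 f u := hf.contDiffAt (hU.mem_nhds hu)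
  have hd : DifferentiableAt ℝ (fderiv ℝ f) u :=
    (hf2.fderiv_right (m := 1) (by norm_num)).differentiableAt one_ne_zero
  have h (μ ν : Fin 4) :
      pd μ (pd ν f) u = fderiv ℝ (fderiv ℝ f) u (Pi.single μ 1) (Pi.single ν 1) := by
    change fderiv ℝ (fun v => fderiv ℝ f v (Pi.single ν 1)) u _ = _
    rw [fderiv_clm_apply hd (differentiableAt_const _)]
    simp
  rw [h, h]
  exact hf2.isSymmSndFDerivAt (by simp) _ _

theorem contDiffOn_det {X : Type*} [NormedAddCommGroup X] [NormedSpace ℝ X] {U : Set X}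
    {n : WithTop ℕ∞} {A : X → Matrix (Fin 4) (Fin 4) ℝ}
    (hA : ∀ i j, ContDiffOn ℝ n (fun u => A u i j) U) : ContDiffOn ℝ n (fun u => (A u).det) U := by
  simp only [Matrix.det_apply']
  exact ContDiffOn.sum fun σ _ => contDiffOn_const.mul (contDiffOn_prod fun i _ => hA _ _)

theorem contDiffOn_inv {X : Type*} [NormedAddCommGroup X] [NormedSpace ℝ X] {U : Set X}
    {n : WithTop ℕ∞} {A : X → Matrix (Fin 4) (Fin 4) ℝ}
    (hA : ∀ i j, ContDiffOn ℝ n (fun u => A u i j) U) (h0 : ∀ u ∈ U, (A u).det ≠ 0) (i j : Fin 4) :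
    ContDiffOn ℝ n (fun u => (A u)⁻¹ i j) U := by
  simp only [Matrix.inv_def, Ring.inverse_eq_inv', Matrix.smul_apply, smul_eq_mul,
    Matrix.adjugate_apply]
  refine ((contDiffOn_det hA).inv h0).mul (contDiffOn_det fun k l => ?_)
  by_cases hk : k = j
  · subst hk
    simpa using contDiffOn_const
  · simpa [Matrix.updateRow_ne hk] using hA k l

theorem contDiffOn_mul_apply {X : Type*} [NormedAddCommGroup X] [NormedSpace ℝ X] {U : Set X}
    {n : WithTop ℕ∞} {A B : X → Matrix (Fin 4) (Fin 4) ℝ}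
    (hA : ∀ i j, ContDiffOn ℝ n (fun u => A u i j) U)
    (hB : ∀ i j, ContDiffOn ℝ n (fun u => B u i j) U) (i j : Fin 4) :
    ContDiffOn ℝ n (fun u => (A u * B u) i j) U := by
  simp only [Matrix.mul_apply]
  exact ContDiffOn.sum fun k _ => (hA i k).mul (hB k j)

/-! ### Partial derivatives of matrix fields -/

/-- The entrywise partial derivative of a matrix field. -/
def pdMat (μ : Fin 4) (A : Pt → Matrix (Fin 4) (Fin 4) ℝ) (u : Pt) : Matrix (Fin 4) (Fin 4) ℝ :=
  Matrix.of fun i j => pd μ (fun v => A v i j) u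

theorem pdMat_congr {A B : Pt → Matrix (Fin 4) (Fin 4) ℝ} {u : Pt} (h : A =ᶠ[𝓝 u] B) (μ : Fin 4) :
    pdMat μ A u = pdMat μ B u := by
  ext i j
  exact pd_congr (h.mono fun v hv => by simp only [hv]) μ

theorem pdMat_transpose (A : Pt → Matrix (Fin 4) (Fin 4) ℝ) (u : Pt) (μ : Fin 4) :
    pdMat μ (fun v => (A v).transpose) u = (pdMat μ A u).transpose := rfl

theorem pdMat_mul {A B : Pt → Matrix (Fin 4) (Fin 4) ℝ} {u : Pt}
    (hA : ∀ i j, DifferentiableAt ℝ (fun v => A v i j) u)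
    (hB : ∀ i j, DifferentiableAt ℝ (fun v => B v i j) u) (μ : Fin 4) :
    pdMat μ (fun v => A v * B v) u = pdMat μ A u * B u + A u * pdMat μ B u := by
  ext i j
  simp only [pdMat, Matrix.mul_apply, Matrix.of_apply, Matrix.add_apply]
  rw [pd_sum fun k => (hA i k).fun_mul (hB k j), ← sum_add_distrib]
  exact sum_congr rfl fun k _ => pd_mul (hA i k) (hB k j) μ

/-- The matrix of the connection 1-forms evaluated on `∂/∂u^μ`. -/
def connMat (Γ : ConnForms) (μ : Fin 4) (u : Pt) : Matrix (Fin 4) (Fin 4) ℝ :=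
  Matrix.of fun α β => Γ u α β μ

theorem isMetricCompatible_iff {U : Set Pt} {g : FrameMetric} {Γ : ConnForms} :
    IsMetricCompatible U g Γ ↔ ∀ u ∈ U, ∀ μ,
      pdMat μ g u = (connMat Γ μ u).transpose * g u + g u * connMat Γ μ u := by
  have key (u α β μ) : ((connMat Γ μ u).transpose * g u + g u * connMat Γ μ u) α β =
      ∑ γ, (g u γ β * Γ u γ α μ + g u α γ * Γ u γ β μ) := by
    simp [Matrix.mul_apply, connMat, sum_add_distrib, mul_comm]
  constructor
  · intro h u hu μ
    ext α β
    rw [key]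
    exact h u hu α β μ
  · intro h u hu α β μ
    rw [← key, ← h u hu μ]
    rfl

/-! ### Curvature of a metric-compatible connection -/

/-- Differentiating `D g = 0` once more, and antisymmetrizing, gives `C_{αβ} = -C_{βα}`. -/
theorem curv_lower_antisymm {U : Set Pt} (hU : IsOpen U) {g : FrameMetric}
    (hg : ∀ α β, ContDiffOn ℝ 2 (fun u => g u α β) U) {Γ : ConnForms}
    (hΓ : ∀ α β μ, ContDiffOn ℝ 1 (fun u => Γ u α β μ) U) (h : IsMetricCompatible U g Γ)
    {u : Pt} (hu : u ∈ U) (α β μ ν : Fin 4) :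
    ∑ γ, (g u γ β * curv Γ u γ α μ ν + g u α γ * curv Γ u γ β μ ν) = 0 := by
  have dg (α β) : DifferentiableAt ℝ (fun v => g v α β) u :=
    ((hg α β).contDiffAt (hU.mem_nhds hu)).differentiableAt two_ne_zero
  have dΓ (α β μ) : DifferentiableAt ℝ (fun v => Γ v α β μ) u :=
    ((hΓ α β μ).contDiffAt (hU.mem_nhds hu)).differentiableAt one_ne_zero
  have key (μ ν : Fin 4) : pd ν (pd μ fun v => g v α β) u = ∑ γ,
      ((pd ν (fun v => g v γ β) u * Γ u γ α μ + g u γ β * pd ν (fun v => Γ v γ α μ) u) +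
        (pd ν (fun v => g v α γ) u * Γ u γ β μ + g u α γ * pd ν (fun v => Γ v γ β μ) u)) := by
    have e : (pd μ fun v => g v α β) =ᶠ[𝓝 u]
        fun v => ∑ γ, (g v γ β * Γ v γ α μ + g v α γ * Γ v γ β μ) :=
      (hU.eventually_mem hu).mono fun v hv => h v hv α β μ
    rw [pd_congr e,
      pd_sum fun γ => ((dg _ _).fun_mul (dΓ _ _ _)).fun_add ((dg _ _).fun_mul (dΓ _ _ _))]
    refine sum_congr rfl fun γ _ => ?_
    rw [pd_add ((dg _ _).fun_mul (dΓ _ _ _)) ((dg _ _).fun_mul (dΓ _ _ _)),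
      pd_mul (dg _ _) (dΓ _ _ _), pd_mul (dg _ _) (dΓ _ _ _)]
  have hs := pd_pd_comm hU (hg α β) hu μ ν
  rw [key, key] at hs
  simp only [h u hu, Fin.sum_univ_four] at hs
  simp only [curv, Fin.sum_univ_four]
  linear_combination hs

theorem isAntisymm_curv {U : Set Pt} (hU : IsOpen U) {g : FrameMetric}
    (hg : ∀ α β, ContDiffOn ℝ 2 (fun u => g u α β) U) (hs : ∀ u ∈ U, (g u).IsSymm)
    (h0 : ∀ u ∈ U, (g u).det ≠ 0) {Γ : ConnForms}
    (hΓ : ∀ α β μ, ContDiffOn ℝ 1 (fun u => Γ u α β μ) U) (h : IsMetricCompatible U g Γ)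
    {u : Pt} (hu : u ∈ U) : IsAntisymm (g u) (curv Γ u) where
  form α β μ ν := by simp only [curv, Fin.sum_univ_four]; ring
  up α β μ ν := by
    have hi : ((g u)⁻¹).IsSymm := by rw [Matrix.IsSymm, Matrix.transpose_nonsing_inv, (hs u hu).eq]
    set c : Matrix (Fin 4) (Fin 4) ℝ := Matrix.of fun α β => curv Γ u α β μ ν with hc
    have h1 : c.transpose * g u + g u * c = 0 := by
      ext α β
      have := curv_lower_antisymm hU hg hΓ h hu α β μ ν
      rw [sum_add_distrib] at this
      simpa [Matrix.mul_apply, hc, mul_comm] using this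
    have h2 : (g u)⁻¹ * c.transpose + c * (g u)⁻¹ = 0 := by
      have hl := Matrix.nonsing_inv_mul (g u) (h0 u hu).isUnit
      have hr := Matrix.mul_nonsing_inv (g u) (h0 u hu).isUnit
      calc (g u)⁻¹ * c.transpose + c * (g u)⁻¹
          = (g u)⁻¹ * c.transpose * (g u * (g u)⁻¹) + ((g u)⁻¹ * g u) * c * (g u)⁻¹ := by
            rw [hl, hr, Matrix.mul_one, Matrix.one_mul]
        _ = (g u)⁻¹ * (c.transpose * g u + g u * c) * (g u)⁻¹ := by noncomm_ring
        _ = 0 := by rw [h1, Matrix.mul_zero, Matrix.zero_mul]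
    have h3 := congrFun (congrFun h2 α) β
    simp only [Matrix.add_apply, Matrix.mul_apply, Matrix.transpose_apply, Matrix.zero_apply, hc,
      Matrix.of_apply] at h3
    rw [eq_neg_iff_add_eq_zero, ← h3, add_comm]
    exact congrArg _ (sum_congr rfl fun γ _ => by rw [hi.apply, mul_comm])

/-! ### The Levi-Civita connection -/

section LeviCivita

variable {U : Set Pt} {g : FrameMetric} {E : Coframe}

theorem coordMetric_det_ne_zero (hE : IsAdaptedCoframe U E) (hg : IsDMetric U g) {u : Pt}
    (hu : u ∈ U) : (coordMetric g E u).det ≠ 0 := by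
  rw [coordMetric, Matrix.det_mul, Matrix.det_mul, Matrix.det_transpose]
  exact mul_ne_zero (mul_ne_zero (hE.det_ne_zero u hu) (hg.det_ne_zero u hu)) (hE.det_ne_zero u hu)

theorem contDiffOn_frame (hE : IsAdaptedCoframe U E) (μ α : Fin 4) :
    ContDiffOn ℝ 2 (fun u => frame (E u) μ α) U :=
  contDiffOn_inv hE.contDiffOn hE.det_ne_zero μ α

theorem contDiffOn_coordMetric (hE : IsAdaptedCoframe U E) (hg : IsDMetric U g) (μ ν : Fin 4) :
    ContDiffOn ℝ 2 (fun u => coordMetric g E u μ ν) U :=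
  contDiffOn_mul_apply (contDiffOn_mul_apply (fun i j => hE.contDiffOn j i) hg.contDiffOn)
    hE.contDiffOn μ ν

theorem contDiffOn_leviCivita (hU : IsOpen U) (hE : IsAdaptedCoframe U E) (hg : IsDMetric U g)
    (α β μ : Fin 4) : ContDiffOn ℝ 1 (fun u => leviCivita g E u α β μ) U := by
  have h12 : (1 : WithTop ℕ∞) ≤ 2 := by norm_num
  have h11 : (1 : WithTop ℕ∞) + 1 ≤ 2 := by norm_num
  have hc (μ ν ρ : Fin 4) := contDiffOn_pd hU (contDiffOn_coordMetric hE hg μ ν) h11 ρ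
  have hi := contDiffOn_inv (contDiffOn_coordMetric hE hg)
    fun u hu => coordMetric_det_ne_zero hE hg hu
  have hchr (ρ μ ν : Fin 4) : ContDiffOn ℝ 1 (fun u => christoffel g E u ρ μ ν) U :=
    contDiffOn_const.mul <| ContDiffOn.sum fun σ _ => ((hi ρ σ).of_le h12).mul
      (((hc σ ν μ).add (hc σ μ ν)).sub (hc μ ν σ))
  exact ContDiffOn.sum fun ρ _ => ((hE.contDiffOn α ρ).of_le h12).mul <|
    (contDiffOn_pd hU (contDiffOn_frame hE ρ β) h11 μ).add <|
      ContDiffOn.sum fun ν _ => (hchr ρ μ ν).mul ((contDiffOn_frame hE ν β).of_le h12)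

/-- In matrix form: `g = Fᵀ G F` with `F` the frame and `G` the coordinate metric, the connection
matrix is `E (∂F + G⁻¹ L F)` with `L` the lowered Christoffel symbols, and `L + Lᵀ = ∂G`. -/
theorem isMetricCompatible_leviCivita (hU : IsOpen U) (hE : IsAdaptedCoframe U E)
    (hg : IsDMetric U g) : IsMetricCompatible U g (leviCivita g E) := by
  rw [isMetricCompatible_iff]
  intro u hu μ
  have hd {f : Pt → ℝ} (hf : ContDiffOn ℝ 2 f U) : DifferentiableAt ℝ f u :=
    (hf.contDiffAt (hU.mem_nhds hu)).differentiableAt two_ne_zero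
  have hFE {v : Pt} (hv : v ∈ U) : E v * frame (E v) = 1 :=
    Matrix.mul_nonsing_inv _ (hE.det_ne_zero v hv).isUnit
  have hFE' {v : Pt} (hv : v ∈ U) : (frame (E v)).transpose * (E v).transpose = 1 := by
    rw [← Matrix.transpose_mul, hFE hv, Matrix.transpose_one]
  have hgG {v : Pt} (hv : v ∈ U) :
      g v = (frame (E v)).transpose * coordMetric g E v * frame (E v) := by
    calc g v = ((frame (E v)).transpose * (E v).transpose) * g v * (E v * frame (E v)) := by
          rw [hFE hv, hFE' hv, Matrix.one_mul, Matrix.mul_one]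
      _ = _ := by simp only [coordMetric, Matrix.mul_assoc]
  have hGs {v : Pt} (hv : v ∈ U) : (coordMetric g E v).transpose = coordMetric g E v := by
    simp only [coordMetric, Matrix.transpose_mul, Matrix.transpose_transpose, (hg.symm v hv).eq,
      Matrix.mul_assoc]
  set F := frame (E u)
  set G := coordMetric g E u with hG
  set dF := pdMat μ (fun v => frame (E v)) u with hdF
  set dG := pdMat μ (coordMetric g E) u with hdG
  -- the Christoffel symbols with the first index lowered
  set low : Matrix (Fin 4) (Fin 4) ℝ := Matrix.of fun σ ν => 1 / 2 *
    (pd μ (fun v => coordMetric g E v σ ν) u + pd ν (fun v => coordMetric g E v σ μ) u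
      - pd σ (fun v => coordMetric g E v μ ν) u) with hlow
  have hpd : pdMat μ g u = dF.transpose * G * F + F.transpose * dG * F + F.transpose * G * dF := by
    have e : g =ᶠ[𝓝 u] fun v => ((frame (E v)).transpose * coordMetric g E v) * frame (E v) :=
      (hU.eventually_mem hu).mono fun v hv => hgG hv
    have hF (i j) := hd (contDiffOn_frame hE i j)
    have hG' (i j) := hd (contDiffOn_coordMetric hE hg i j)
    rw [pdMat_congr e, pdMat_mul (A := fun v => (frame (E v)).transpose * coordMetric g E v)
      (fun i j => hd (contDiffOn_mul_apply (fun i j => contDiffOn_frame hE j i)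
        (contDiffOn_coordMetric hE hg) i j)) hF,
      pdMat_mul (A := fun v => (frame (E v)).transpose) (fun i j => hF j i) hG',
      pdMat_transpose (fun v => frame (E v)), Matrix.add_mul]
  have hsym (μ σ ν : Fin 4) : pd μ (fun v => coordMetric g E v σ ν) u =
      pd μ (fun v => coordMetric g E v ν σ) u :=
    pd_congr ((hU.eventually_mem hu).mono fun v hv => by
      change coordMetric g E v σ ν = (coordMetric g E v).transpose σ ν
      rw [hGs hv]) μ
  have hlow2 : low.transpose + low = dG := by
    ext σ ν
    simp only [hlow, hdG, pdMat, Matrix.add_apply, Matrix.transpose_apply, Matrix.of_apply]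
    rw [hsym μ ν σ, hsym ν μ σ, hsym σ μ ν]
    ring
  have hconn : connMat (leviCivita g E) μ u = E u * (dF + G⁻¹ * low * F) := by
    have hchr (ρ ν : Fin 4) : christoffel g E u ρ μ ν = (G⁻¹ * low) ρ ν := by
      simp only [christoffel, hlow, hG, Matrix.mul_apply, Matrix.of_apply, mul_sum]
      exact sum_congr rfl fun σ _ => by ring
    ext α β
    simp only [connMat, Matrix.of_apply, leviCivita, hchr]
    rfl
  have hGG : G * G⁻¹ = 1 := Matrix.mul_nonsing_inv _ (coordMetric_det_ne_zero hE hg hu).isUnit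
  have hgA : g u * connMat (leviCivita g E) μ u = F.transpose * G * dF + F.transpose * low * F := by
    rw [hconn, hgG hu]
    calc F.transpose * G * F * (E u * (dF + G⁻¹ * low * F))
        = F.transpose * G * (F * E u) * dF + F.transpose * (G * (F * E u) * G⁻¹) * low * F := by
          noncomm_ring
      _ = _ := by
          rw [show F * E u = 1 from Matrix.nonsing_inv_mul _ (hE.det_ne_zero u hu).isUnit,
            Matrix.mul_one, Matrix.mul_one, hGG, Matrix.mul_one]
  have hAg : (connMat (leviCivita g E) μ u).transpose * g u =
      dF.transpose * G * F + F.transpose * low.transpose * F := by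
    rw [← (hg.symm u hu).eq, ← Matrix.transpose_mul, hgA]
    simp only [Matrix.transpose_add, Matrix.transpose_mul, Matrix.transpose_transpose, hG, hGs hu,
      Matrix.mul_assoc]
  rw [hpd, hAg, hgA, ← hlow2]
  noncomm_ring

/-! ### Distortion -/

theorem curv_leviCivita (hU : IsOpen U) (hE : IsAdaptedCoframe U E) (hg : IsDMetric U g)
    {Γ : ConnForms} (hΓ : ∀ α β μ, ContDiffOn ℝ 1 (fun u => Γ u α β μ) U) {u : Pt} (hu : u ∈ U)
    (α β μ ν : Fin 4) : curv (leviCivita g E) u α β μ ν =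
      curv Γ u α β μ ν + distCurv Γ (distortion g E Γ) u α β μ ν := by
  have hd {f : Pt → ℝ} (hf : ContDiffOn ℝ 1 f U) : DifferentiableAt ℝ f u :=
    (hf.contDiffAt (hU.mem_nhds hu)).differentiableAt one_ne_zero
  have h (α β ν μ : Fin 4) : pd μ (fun v => distortion g E Γ v α β ν) u =
      pd μ (fun v => leviCivita g E v α β ν) u - pd μ (fun v => Γ v α β ν) u :=
    pd_sub (hd (contDiffOn_leviCivita hU hE hg α β ν)) (hd (hΓ α β ν)) μ
  simp only [distCurv, h]
  simp only [curv, distortion, Fin.sum_univ_four]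
  ring

theorem isAntisymm_distCurv (hU : IsOpen U) (hE : IsAdaptedCoframe U E) (hg : IsDMetric U g)
    {Γ : ConnForms} (hΓ : ∀ α β μ, ContDiffOn ℝ 1 (fun u => Γ u α β μ) U)
    (hΓg : IsMetricCompatible U g Γ) {u : Pt} (hu : u ∈ U) :
    IsAntisymm (g u) (distCurv Γ (distortion g E Γ) u) := by
  have h1 := isAntisymm_curv hU hg.contDiffOn hg.symm hg.det_ne_zero hΓ hΓg hu
  have h2 := isAntisymm_curv hU hg.contDiffOn hg.symm hg.det_ne_zero
    (contDiffOn_leviCivita hU hE hg) (isMetricCompatible_leviCivita hU hE hg) hu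
  have e (α β μ ν : Fin 4) : distCurv Γ (distortion g E Γ) u α β μ ν =
      curv (leviCivita g E) u α β μ ν - curv Γ u α β μ ν := by
    rw [curv_leviCivita hU hE hg hΓ hu]; ring
  constructor
  · intro α β μ ν
    rw [e, e, h1.form, h2.form]; ring
  · intro α β μ ν
    simp only [e, mul_sub, sum_sub_distrib]
    rw [h1.up, h2.up]; ring

theorem continuousOn_curv (hU : IsOpen U) {Γ : ConnForms}
    (hΓ : ∀ α β μ, ContDiffOn ℝ 1 (fun u => Γ u α β μ) U) (α β μ ν : Fin 4) :
    ContinuousOn (fun u => curv Γ u α β μ ν) U := by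
  have hp (α β μ ν : Fin 4) : ContinuousOn (fun u => pd ν (fun v => Γ v α β μ) u) U :=
    (contDiffOn_pd hU (m := 0) (hΓ α β μ) (by norm_num) ν).continuousOn
  have hc (α β μ : Fin 4) := (hΓ α β μ).continuousOn
  exact ((hp α β ν μ).sub (hp α β μ ν)).add <| continuousOn_finsetSum _ fun γ _ =>
    ((hc α γ μ).mul (hc γ β ν)).sub ((hc α γ ν).mul (hc γ β μ))

theorem continuousOn_distCurv (hU : IsOpen U) (hE : IsAdaptedCoframe U E) (hg : IsDMetric U g)
    {Γ : ConnForms} (hΓ : ∀ α β μ, ContDiffOn ℝ 1 (fun u => Γ u α β μ) U) (α β μ ν : Fin 4) :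
    ContinuousOn (fun u => distCurv Γ (distortion g E Γ) u α β μ ν) U :=
  ((continuousOn_curv hU (contDiffOn_leviCivita hU hE hg) α β μ ν).sub
    (continuousOn_curv hU hΓ α β μ ν)).congr fun _ hu =>
    eq_sub_of_add_eq' (curv_leviCivita hU hE hg hΓ hu α β μ ν).symm

end LeviCivita

open MeasureTheory

/-! ### The first variation of the Lagrangian density -/

theorem hasDerivAt_entry (e δ : Matrix (Fin 4) (Fin 4) ℝ) (t : ℝ) (i j : Fin 4) :
    HasDerivAt (fun s : ℝ => (e + s • δ) i j) (δ i j) t := by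
  simpa using ((hasDerivAt_id t).mul_const (δ i j)).const_add (e i j)

/-- The derivative of the inverse matrix, found by differentiating `e⁻¹ e = 1`. -/
theorem hasDerivAt_frame {e δ : Matrix (Fin 4) (Fin 4) ℝ} {t : ℝ} (h : (e + t • δ).det ≠ 0)
    (μ α : Fin 4) : HasDerivAt (fun s : ℝ => frame (e + s • δ) μ α)
      (-(frame (e + t • δ) * δ * frame (e + t • δ)) μ α) t := by
  set A : ℝ → Matrix (Fin 4) (Fin 4) ℝ := fun s => e + s • δ with hA
  have hc (i j) : ContDiff ℝ 1 (fun s => A s i j) := by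
    simp only [hA, Matrix.add_apply, Matrix.smul_apply, smul_eq_mul]
    fun_prop
  have hdet : ContDiff ℝ 1 (fun s => (A s).det) :=
    contDiffOn_univ.1 (contDiffOn_det fun i j => (hc i j).contDiffOn)
  have hO : IsOpen {s | (A s).det ≠ 0} := isOpen_ne_fun hdet.continuous continuous_const
  have hd (i j) : DifferentiableAt ℝ (fun s => frame (A s) i j) t :=
    ((contDiffOn_inv (fun i j => (hc i j).contDiffOn) (fun s hs => hs) i j).contDiffAt
      (hO.mem_nhds h)).differentiableAt one_ne_zero
  set D : Matrix (Fin 4) (Fin 4) ℝ := Matrix.of fun i j => deriv (fun s => frame (A s) i j) t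
  have hD : D * A t + frame (A t) * δ = 0 := by
    ext i j
    have h1 : HasDerivAt (fun s => ∑ k, frame (A s) i k * A s k j)
        (∑ k, (D i k * A t k j + frame (A t) i k * δ k j)) t :=
      HasDerivAt.fun_sum fun k _ => (hd i k).hasDerivAt.mul (hasDerivAt_entry e δ t k j)
    have h2 : (fun s => ∑ k, frame (A s) i k * A s k j) =ᶠ[𝓝 t]
        fun _ => (1 : Matrix (Fin 4) (Fin 4) ℝ) i j :=
      (hO.eventually_mem h).mono fun s hs => by
        rw [← Matrix.nonsing_inv_mul (A s) (IsUnit.mk0 _ hs), Matrix.mul_apply]; rfl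
    have h3 := h1.unique ((hasDerivAt_const t _).congr_of_eventuallyEq h2)
    rw [sum_add_distrib] at h3
    simpa [Matrix.mul_apply] using h3
  have hDF : D = -(frame (A t) * δ * frame (A t)) := by
    have h1 : A t * frame (A t) = 1 := Matrix.mul_nonsing_inv _ (IsUnit.mk0 _ h)
    calc D = D * (A t * frame (A t)) := by rw [h1, Matrix.mul_one]
      _ = (D * A t + frame (A t) * δ) * frame (A t) - frame (A t) * δ * frame (A t) := by
        noncomm_ring
      _ = _ := by rw [hD, Matrix.zero_mul, zero_sub]
  exact (hd μ α).hasDerivAt.congr_deriv (congrFun (congrFun hDF μ) α)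

/-- Jacobi's formula, from `det (e + s δ) = det (e + t δ) det (1 + (s - t) e_t⁻¹ δ)`. -/
theorem hasDerivAt_det {e δ : Matrix (Fin 4) (Fin 4) ℝ} {t : ℝ} (h : (e + t • δ).det ≠ 0) :
    HasDerivAt (fun s : ℝ => (e + s • δ).det)
      ((e + t • δ).det * (frame (e + t • δ) * δ).trace) t := by
  set M := frame (e + t • δ) * δ with hM
  have h1 (s : ℝ) : (e + s • δ).det = (e + t • δ).det * (1 + (s - t) • M).det := by
    rw [← Matrix.det_mul]
    congr 1
    rw [Matrix.mul_add, Matrix.mul_one, Matrix.mul_smul, hM, ← Matrix.mul_assoc, frame,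
      Matrix.mul_nonsing_inv _ (IsUnit.mk0 _ h), Matrix.one_mul, sub_smul]
    abel
  have h0 : HasDerivAt (fun s : ℝ => s - t) 1 t := (hasDerivAt_id t).sub_const t
  have h2 : HasDerivAt (fun s : ℝ => (1 + (s - t) • M).det) M.trace t := by
    rw [funext fun s : ℝ => Matrix.det_one_add_smul (s - t) M]
    set p := (Matrix.det (1 + (Polynomial.X : Polynomial ℝ) •
      M.map Polynomial.C)).divX.divX
    have h3 : HasDerivAt (fun s : ℝ => p.eval (s - t)) (p.derivative.eval (t - t) * 1) t :=
      HasDerivAt.comp (h := fun s : ℝ => s - t) t (p.hasDerivAt (t - t)) h0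
    have := ((h0.const_mul M.trace).const_add 1).fun_add (h3.fun_mul (h0.fun_pow 2))
    simpa using this
  rw [funext h1]
  simpa using h2.const_mul (e + t • δ).det

theorem hasDerivAt_volDensity (g : Matrix (Fin 4) (Fin 4) ℝ) {e δ : Matrix (Fin 4) (Fin 4) ℝ}
    {t : ℝ} (h : (e + t • δ).det ≠ 0) : HasDerivAt (fun s : ℝ => volDensity g (e + s • δ))
      (volDensity g (e + t • δ) * (frame (e + t • δ) * δ).trace) t := by
  have := ((hasDerivAt_abs h).comp t (hasDerivAt_det h)).const_mul √|g.det|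
  rw [← mul_assoc ((SignType.sign _ : SignType) : ℝ), sign_mul_self, ← mul_assoc] at this
  exact this

/-- The scalar curvature as a quadratic form in the frame, polarized: `scalarPolar g C X X` is the
scalar contraction of `C` in the frame `X`. -/
def scalarPolar (g : Matrix (Fin 4) (Fin 4) ℝ) (C : Curv) (X Y : Matrix (Fin 4) (Fin 4) ℝ) : ℝ :=
  ∑ α, ∑ β, g⁻¹ α β * ∑ κ, ∑ μ, ∑ ν, C κ α μ ν * X μ κ * Y ν β

theorem scalarPolar_eq {g : Matrix (Fin 4) (Fin 4) ℝ} (hg : g.IsSymm) (C : Curv)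
    (X Y : Matrix (Fin 4) (Fin 4) ℝ) : scalarPolar g C X Y =
      ∑ κ, ∑ β, ∑ μ, ∑ ν, (∑ α, g⁻¹ β α * C κ α μ ν) * X μ κ * Y ν β := by
  have hs : (g⁻¹).IsSymm := by rw [Matrix.IsSymm, Matrix.transpose_nonsing_inv, hg.eq]
  simp only [scalarPolar, mul_sum, sum_mul]
  rw [sum_comm_cycle]
  refine sum_congr rfl fun κ _ => ?_
  rw [sum_comm]
  refine sum_congr rfl fun β _ => ?_
  rw [sum_comm]
  refine sum_congr rfl fun μ _ => ?_
  rw [sum_comm]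
  refine sum_congr rfl fun ν _ => sum_congr rfl fun α _ => ?_
  rw [hs.apply]; ring

/-- `C^{αβ}_{μν}` does not change when the indices are exchanged in both pairs at once, so both
frames in the scalar curvature contribute equally to its variation. -/
theorem scalarPolar_comm {g : Matrix (Fin 4) (Fin 4) ℝ} (hg : g.IsSymm) {C : Curv}
    (h : IsAntisymm g C) (X Y : Matrix (Fin 4) (Fin 4) ℝ) :
    scalarPolar g C X Y = scalarPolar g C Y X := by
  rw [scalarPolar_eq hg, scalarPolar_eq hg, sum_comm]
  refine sum_congr rfl fun β _ => sum_congr rfl fun κ _ => ?_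
  rw [sum_comm]
  refine sum_congr rfl fun ν _ => sum_congr rfl fun μ _ => ?_
  have h1 : ∑ α, g⁻¹ β α * C κ α μ ν = ∑ α, g⁻¹ κ α * C β α ν μ := by
    rw [h.up, ← sum_neg_distrib]
    exact sum_congr rfl fun α _ => by rw [h.form β α μ ν]; ring
  rw [h1]; ring

/-- Varying one of the two frames in the scalar curvature gives the Ricci contraction. In matrix
form this is the cyclicity of the trace. -/
theorem scalarPolar_frame {g : Matrix (Fin 4) (Fin 4) ℝ} (hg : g.IsSymm)
    (e δ : Matrix (Fin 4) (Fin 4) ℝ) (C : Curv) :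
    scalarPolar g C (frame e) (-(frame e * δ * frame e)) =
      -∑ μ, ∑ τ, ricciMixed g e C μ τ * δ τ μ := by
  have hs : (g⁻¹).IsSymm := by rw [Matrix.IsSymm, Matrix.transpose_nonsing_inv, hg.eq]
  set F := frame e with hF
  set P : Matrix (Fin 4) (Fin 4) ℝ := Matrix.of fun α ν => ∑ κ, ∑ μ, C κ α μ ν * F μ κ with hP
  have h1 (Y : Matrix (Fin 4) (Fin 4) ℝ) : scalarPolar g C F Y = (g⁻¹ * (P * Y)).trace := by
    rw [scalarPolar, sum_comm]
    simp only [Matrix.trace, Matrix.diag_apply]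
    refine sum_congr rfl fun β _ => ?_
    rw [Matrix.mul_apply]
    refine sum_congr rfl fun α _ => ?_
    rw [hs.apply, Matrix.mul_apply]
    simp only [hP, Matrix.of_apply, sum_mul]
    rw [sum_comm_cycle]
  have h2 (α τ : Fin 4) : ricci e C α τ = (P * F) α τ := by
    simp only [ricci, Matrix.mul_apply, hP, Matrix.of_apply, sum_mul]
    rw [sum_comm_cycle]
  have h3 : ∑ μ, ∑ τ, ricciMixed g e C μ τ * δ τ μ = (F * g⁻¹ * (P * F) * δ).trace := by
    simp only [Matrix.trace, Matrix.diag_apply]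
    refine sum_congr rfl fun μ _ => ?_
    rw [Matrix.mul_apply]
    refine sum_congr rfl fun τ _ => ?_
    rw [Matrix.mul_apply, ricciMixed, sum_comm]
    simp only [h2, Matrix.mul_apply (M := F), sum_mul]
    rfl
  rw [h1, h3, Matrix.mul_neg, Matrix.mul_neg, Matrix.trace_neg, Matrix.mul_assoc F,
    Matrix.mul_assoc F, Matrix.mul_assoc F, Matrix.trace_mul_comm F (_ * δ)]
  simp only [Matrix.mul_assoc]

theorem hasDerivAt_scalarCurv {g : Matrix (Fin 4) (Fin 4) ℝ} (hg : g.IsSymm) {C : Curv}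
    (hC : IsAntisymm g C) {e δ : Matrix (Fin 4) (Fin 4) ℝ} {t : ℝ} (h : (e + t • δ).det ≠ 0) :
    HasDerivAt (fun s : ℝ => scalarCurv g (e + s • δ) C)
      (-2 * ∑ μ, ∑ τ, ricciMixed g (e + t • δ) C μ τ * δ τ μ) t := by
  set F := frame (e + t • δ) with hF
  have hd := hasDerivAt_frame h
  have h1 : HasDerivAt (fun s : ℝ => scalarCurv g (e + s • δ) C)
      (∑ α, ∑ β, g⁻¹ α β * ∑ κ, ∑ μ, ∑ ν,
        (C κ α μ ν * (-(F * δ * F)) μ κ * F ν β + C κ α μ ν * F μ κ * (-(F * δ * F)) ν β)) t :=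
    HasDerivAt.fun_sum fun α _ => HasDerivAt.fun_sum fun β _ => HasDerivAt.const_mul _ <|
      HasDerivAt.fun_sum fun κ _ => HasDerivAt.fun_sum fun μ _ => HasDerivAt.fun_sum fun ν _ =>
        ((hd μ κ).const_mul _).mul (hd ν β)
  refine h1.congr_deriv (Eq.symm ?_)
  have h2 : -2 * ∑ μ, ∑ τ, ricciMixed g (e + t • δ) C μ τ * δ τ μ =
      scalarPolar g C (-(F * δ * F)) F + scalarPolar g C F (-(F * δ * F)) := by
    rw [scalarPolar_comm hg hC _ F, hF, scalarPolar_frame hg]; ring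
  rw [h2]
  simp only [scalarPolar, sum_add_distrib, mul_add]

/-- The pointwise variation of the Lagrangian density. It holds for every parameter at which the
varied coframe is invertible, as the domination of the derivative near `0` needs. -/
theorem hasDerivAt_lagrangian {g : Matrix (Fin 4) (Fin 4) ℝ} (hg : g.IsSymm) {C : Curv}
    (hC : IsAntisymm g C) (lam : ℝ) {e δ : Matrix (Fin 4) (Fin 4) ℝ} {t : ℝ}
    (h : (e + t • δ).det ≠ 0) :
    HasDerivAt (fun s : ℝ => (scalarCurv g (e + s • δ) C + lam) * volDensity g (e + s • δ))
      ((∑ μ, ∑ τ, (-2 * einstein lam g (e + t • δ) C μ τ) * δ τ μ) * volDensity g (e + t • δ))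
      t := by
  refine (((hasDerivAt_scalarCurv hg hC h).add_const lam).mul
    (hasDerivAt_volDensity g h)).congr_deriv ?_
  have h1 : (frame (e + t • δ) * δ).trace = ∑ μ, ∑ τ, frame (e + t • δ) μ τ * δ τ μ := by
    simp [Matrix.trace, Matrix.mul_apply]
  have h2 : ∑ μ, ∑ τ, (-2 * einstein lam g (e + t • δ) C μ τ) * δ τ μ =
      -2 * (∑ μ, ∑ τ, ricciMixed g (e + t • δ) C μ τ * δ τ μ) +
        (scalarCurv g (e + t • δ) C + lam) * ∑ μ, ∑ τ, frame (e + t • δ) μ τ * δ τ μ := by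
    simp only [einstein, mul_sum, ← sum_add_distrib]
    exact sum_congr rfl fun μ _ => sum_congr rfl fun τ _ => by ring
  rw [h1, h2]; ring

/-! ### Differentiation under the integral sign -/

/-- Differentiation under the integral over a compact set. By the tube lemma the integrand is
regular on `[-ε, ε] × K` for some `ε > 0`, and there its derivative is bounded. -/
theorem hasDerivAt_setIntegral_of_continuousOn {S : Set (ℝ × Pt)} (hS : IsOpen S) {K : Set Pt}
    (hK : IsCompact K) (hKS : ∀ u ∈ K, ((0 : ℝ), u) ∈ S) {f f' : ℝ → Pt → ℝ}
    (hf : ContinuousOn (fun p : ℝ × Pt => f p.1 p.2) S)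
    (hf' : ContinuousOn (fun p : ℝ × Pt => f' p.1 p.2) S)
    (hd : ∀ t u, (t, u) ∈ S → HasDerivAt (fun s => f s u) (f' t u) t) :
    HasDerivAt (fun t => ∫ u in K, f t u) (∫ u in K, f' 0 u) 0 := by
  obtain ⟨V, W, hV, -, h0V, hKW, hVW⟩ := generalized_tube_lemma (isCompact_singleton (x := (0 : ℝ)))
    hK hS (by rintro ⟨t, u⟩ ⟨rfl, hu⟩; exact hKS u hu)
  obtain ⟨ε, hε, hεV⟩ := Metric.nhds_basis_closedBall.mem_iff.1
    (hV.mem_nhds (h0V (Set.mem_singleton (0 : ℝ))))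
  have hsub : Metric.closedBall (0 : ℝ) ε ×ˢ K ⊆ S :=
    (Set.prod_mono hεV hKW).trans hVW
  have hslice {h : ℝ → Pt → ℝ} (hh : ContinuousOn (fun p : ℝ × Pt => h p.1 p.2) S) {t : ℝ}
      (ht : t ∈ Metric.closedBall (0 : ℝ) ε) : ContinuousOn (h t) K :=
    hh.comp (f := fun u => (t, u)) (by fun_prop) fun u hu => hsub ⟨ht, hu⟩
  obtain ⟨B, hB⟩ := ((isCompact_closedBall (0 : ℝ) ε).prod hK).exists_bound_of_continuousOn
    (hf'.mono hsub)
  have h0 : (0 : ℝ) ∈ Metric.closedBall (0 : ℝ) ε := Metric.mem_closedBall_self hε.le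
  have hN : Metric.closedBall (0 : ℝ) ε ∈ 𝓝 (0 : ℝ) := Metric.closedBall_mem_nhds _ hε
  exact (hasDerivAt_integral_of_dominated_loc_of_deriv_le (μ := volume.restrict K)
    (bound := fun _ => B) hN
    (Filter.eventually_of_mem hN fun t ht =>
      (hslice hf ht).aestronglyMeasurable hK.measurableSet)
    ((hslice hf h0).integrableOn_compact hK)
    ((hslice hf' h0).aestronglyMeasurable hK.measurableSet)
    ((ae_restrict_mem hK.measurableSet).mono fun u hu t ht => hB (t, u) ⟨ht, hu⟩)
    (integrableOn_const hK.measure_lt_top.ne)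
    ((ae_restrict_mem hK.measurableSet).mono fun u hu t ht => hd t u (hsub ⟨ht, hu⟩))).2


/-! ### Euler-Lagrange equations in the coframe -/

section Continuity

variable {X : Type*} [TopologicalSpace X] {S : Set X} {g e : X → Matrix (Fin 4) (Fin 4) ℝ}
  {C : X → Curv}

theorem continuousOn_ricci (he : ∀ μ α, ContinuousOn (fun x => frame (e x) μ α) S)
    (hC : ∀ α β μ ν, ContinuousOn (fun x => C x α β μ ν) S) (β γ : Fin 4) :
    ContinuousOn (fun x => ricci (e x) (C x) β γ) S :=
  continuousOn_finsetSum _ fun α _ => continuousOn_finsetSum _ fun μ _ =>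
    continuousOn_finsetSum _ fun ν _ => ((hC α β μ ν).mul (he μ α)).mul (he ν γ)

theorem continuousOn_scalarCurv (hg : ∀ α β, ContinuousOn (fun x => (g x)⁻¹ α β) S)
    (he : ∀ μ α, ContinuousOn (fun x => frame (e x) μ α) S)
    (hC : ∀ α β μ ν, ContinuousOn (fun x => C x α β μ ν) S) :
    ContinuousOn (fun x => scalarCurv (g x) (e x) (C x)) S :=
  continuousOn_finsetSum _ fun α _ => continuousOn_finsetSum _ fun β _ =>
    (hg α β).mul (continuousOn_ricci he hC α β)

theorem continuousOn_einstein (hg : ∀ α β, ContinuousOn (fun x => (g x)⁻¹ α β) S)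
    (he : ∀ μ α, ContinuousOn (fun x => frame (e x) μ α) S)
    (hC : ∀ α β μ ν, ContinuousOn (fun x => C x α β μ ν) S) (lam : ℝ) (μ τ : Fin 4) :
    ContinuousOn (fun x => einstein lam (g x) (e x) (C x) μ τ) S :=
  (continuousOn_finsetSum _ fun α _ => continuousOn_finsetSum _ fun β _ =>
    ((he μ α).mul (hg α β)).mul (continuousOn_ricci he hC β τ)).sub
    ((continuousOn_const.mul ((continuousOn_scalarCurv hg he hC).add continuousOn_const)).mul
      (he μ τ))

theorem continuousOn_volDensity (hg : ContinuousOn (fun x => (g x).det) S)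
    (he : ContinuousOn (fun x => (e x).det) S) :
    ContinuousOn (fun x => volDensity (g x) (e x)) S :=
  (Real.continuous_sqrt.comp_continuousOn hg.abs).mul he.abs

end Continuity

section Variation

variable {U : Set Pt} {g : FrameMetric} {E : Coframe}

/-- The first variation of the action of a curvature `C` that is kept fixed. -/
theorem hasFunctionalDeriv_action (hU : IsOpen U) (hE : IsAdaptedCoframe U E) (hg : IsDMetric U g)
    {C : Pt → Curv} (hCc : ∀ α β μ ν, ContinuousOn (fun u => C u α β μ ν) U)
    (hC : ∀ u ∈ U, IsAntisymm (g u) (C u)) (G lam : ℝ) :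
    HasFunctionalDeriv U g E
      (fun K e => 1 / (16 * Real.pi * G) *
        ∫ u in K, (scalarCurv (g u) (e u) (C u) + lam) * volDensity (g u) (e u))
      (fun u μ τ => (8 * Real.pi * G)⁻¹ * -einstein lam (g u) (E u) (C u) μ τ) := by
  intro K hK hKU δ hδ
  have hδc (τ μ : Fin 4) : Continuous fun u => δ u τ μ := (hδ.1 τ μ).continuous
  set A : ℝ × Pt → Matrix (Fin 4) (Fin 4) ℝ := fun p => E p.2 + p.1 • δ p.2 with hA
  have hsnd : Set.MapsTo Prod.snd {p : ℝ × Pt | p.2 ∈ U} U := fun _ h => h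
  have hV : IsOpen {p : ℝ × Pt | p.2 ∈ U} := hU.preimage continuous_snd
  have hAc (i j) : ContDiffOn ℝ 0 (fun p => A p i j) {p : ℝ × Pt | p.2 ∈ U} := by
    rw [contDiffOn_zero]
    exact ((hE.contDiffOn i j).continuousOn.comp continuousOn_snd hsnd).add
      (continuousOn_fst.mul ((hδc i j).comp_continuousOn continuousOn_snd))
  have hdet := (contDiffOn_det hAc).continuousOn
  -- the parameters and points at which the varied coframe is invertible
  set S : Set (ℝ × Pt) := {p | p.2 ∈ U} ∩ (fun p => (A p).det) ⁻¹' {0}ᶜ with hSdef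
  have hS : IsOpen S := hdet.isOpen_inter_preimage hV isOpen_compl_singleton
  have hSV : S ⊆ {p : ℝ × Pt | p.2 ∈ U} := Set.inter_subset_left
  have hSU : Set.MapsTo Prod.snd S U := fun _ h => hSV h
  have cF (μ α) : ContinuousOn (fun p => frame (A p) μ α) S :=
    (contDiffOn_inv (fun i j => (hAc i j).mono hSV) (fun p hp => hp.2) μ α).continuousOn
  have cg (α β) : ContinuousOn (fun p : ℝ × Pt => (g p.2)⁻¹ α β) S :=
    (contDiffOn_inv hg.contDiffOn hg.det_ne_zero α β).continuousOn.comp continuousOn_snd hSU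
  have cC (α β μ ν) : ContinuousOn (fun p : ℝ × Pt => C p.2 α β μ ν) S :=
    (hCc α β μ ν).comp continuousOn_snd hSU
  have cv : ContinuousOn (fun p : ℝ × Pt => volDensity (g p.2) (A p)) S :=
    continuousOn_volDensity ((contDiffOn_det hg.contDiffOn).continuousOn.comp continuousOn_snd hSU)
      (hdet.mono hSV)
  have hKS : ∀ u ∈ K, ((0 : ℝ), u) ∈ S := fun u hu =>
    ⟨hKU hu, by simpa [hA] using hE.det_ne_zero u (hKU hu)⟩
  have cL : ContinuousOn (fun p : ℝ × Pt => (scalarCurv (g p.2) (A p) (C p.2) + lam) *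
      volDensity (g p.2) (A p)) S :=
    ((continuousOn_scalarCurv cg cF cC).add continuousOn_const).mul cv
  have cL' : ContinuousOn (fun p : ℝ × Pt =>
      (∑ μ, ∑ τ, (-2 * einstein lam (g p.2) (A p) (C p.2) μ τ) * δ p.2 τ μ) *
        volDensity (g p.2) (A p)) S :=
    (continuousOn_finsetSum _ fun μ _ => continuousOn_finsetSum _ fun τ _ =>
      (continuousOn_const.mul (continuousOn_einstein cg cF cC lam μ τ)).mul
        ((hδc τ μ).comp_continuousOn continuousOn_snd)).mul cv
  have hd (t : ℝ) (u : Pt) (hu : (t, u) ∈ S) : HasDerivAt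
      (fun s => (scalarCurv (g u) (E u + s • δ u) (C u) + lam) * volDensity (g u) (E u + s • δ u))
      ((∑ μ, ∑ τ, (-2 * einstein lam (g u) (E u + t • δ u) (C u) μ τ) * δ u τ μ) *
        volDensity (g u) (E u + t • δ u)) t :=
    hasDerivAt_lagrangian (hg.symm u (hSV hu)) (hC u (hSV hu)) lam hu.2
  have key := (hasDerivAt_setIntegral_of_continuousOn hS hK hKS cL cL' hd).const_mul
    (1 / (16 * Real.pi * G))
  refine key.congr_deriv ?_
  rw [← integral_const_mul]
  refine integral_congr_ae (Eventually.of_forall fun u => ?_)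
  simp only [zero_smul, add_zero, ← mul_assoc]
  congr 1
  simp only [mul_sum]
  refine sum_congr rfl fun μ _ => sum_congr rfl fun τ _ => ?_
  rw [show (16 : ℝ) * Real.pi * G = 2 * (8 * Real.pi * G) by ring, one_div, mul_inv]
  ring

theorem continuousOn_density (hE : IsAdaptedCoframe U E) (hg : IsDMetric U g) :
    ContinuousOn (fun u => volDensity (g u) (E u)) U :=
  continuousOn_volDensity (contDiffOn_det hg.contDiffOn).continuousOn
    (contDiffOn_det hE.contDiffOn).continuousOn

theorem HasFunctionalDeriv.add (hE : IsAdaptedCoframe U E) (hg : IsDMetric U g)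
    {S₁ S₂ : Action} {T₁ T₂ : MixedTensor} (h₁ : HasFunctionalDeriv U g E S₁ T₁)
    (h₂ : HasFunctionalDeriv U g E S₂ T₂) (c₁ : ∀ μ τ, ContinuousOn (fun u => T₁ u μ τ) U)
    (c₂ : ∀ μ τ, ContinuousOn (fun u => T₂ u μ τ) U) :
    HasFunctionalDeriv U g E (fun K e => S₁ K e + S₂ K e)
      (fun u μ τ => T₁ u μ τ + T₂ u μ τ) := by
  intro K hK hKU δ hδ
  have hi {T : MixedTensor} (c : ∀ μ τ, ContinuousOn (fun u => T u μ τ) U) :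
      IntegrableOn (fun u => (∑ μ, ∑ τ, T u μ τ * δ u τ μ) * volDensity (g u) (E u)) K :=
    (((continuousOn_finsetSum _ fun μ _ => continuousOn_finsetSum _ fun τ _ =>
      (c μ τ).mul (hδ.1 τ μ).continuous.continuousOn).mul
        (continuousOn_density hE hg)).mono hKU).integrableOn_compact hK
  refine ((h₁ K hK hKU δ hδ).fun_add (h₂ K hK hKU δ hδ)).congr_deriv ?_
  rw [← integral_add (hi c₁) (hi c₂)]
  simp only [add_mul, sum_add_distrib]

/-- The fundamental lemma of the calculus of variations, for variations of the coframe. -/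
theorem isStationary_iff (hU : IsOpen U) (hE : IsAdaptedCoframe U E) (hg : IsDMetric U g)
    {S : Action} {T : MixedTensor} (h : HasFunctionalDeriv U g E S T)
    (hT : ∀ μ τ, ContinuousOn (fun u => T u μ τ) U) :
    IsStationary U E S ↔ ∀ u ∈ U, ∀ μ τ, T u μ τ = 0 := by
  constructor
  · intro hS u hu μ τ
    have cT : ContinuousOn (fun u => T u μ τ * volDensity (g u) (E u)) U :=
      (hT μ τ).mul (continuousOn_density hE hg)
    have hae : ∀ᵐ u, u ∈ U → T u μ τ * volDensity (g u) (E u) = 0 := by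
      refine hU.ae_eq_zero_of_integral_contDiff_smul_eq_zero
        (cT.locallyIntegrableOn hU.measurableSet) fun φ hφ hφc hφU => ?_
      -- vary the single component `e^τ_μ` of the coframe
      set δ : Coframe := fun u => Matrix.single τ μ (φ u) with hδ
      have hvar : IsVariation (tsupport φ) δ := by
        refine ⟨fun α ν => ?_, fun v hv => ?_⟩
        · simp only [hδ, Matrix.single_apply]
          split_ifs
          · exact hφ
          · exact contDiff_const
        · simp [hδ, image_eq_zero_of_notMem_tsupport hv]
      have h0 := (h _ hφc hφU δ hvar).unique (hS _ hφc hφU δ hvar)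
      rw [← setIntegral_eq_integral_of_forall_compl_eq_zero (s := tsupport φ) fun v hv => by
        rw [image_eq_zero_of_notMem_tsupport hv, zero_smul], ← h0]
      refine integral_congr_ae (Eventually.of_forall fun v => ?_)
      have h1 : ∑ ν, ∑ α, T v ν α * δ v α ν = T v μ τ * φ v := by
        rw [sum_eq_single μ, sum_eq_single τ]
        · simp [hδ]
        · intro α _ hα
          simp [hδ, hα.symm]
        · simp
        · intro ν _ hν
          simp [hδ, hν.symm]
        · simp
      simp only [h1, smul_eq_mul]
      ring
    have h2 := Measure.eqOn_open_of_ae_eq (μ := volume) (g := fun _ => (0 : ℝ))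
      ((ae_restrict_iff' hU.measurableSet).2 hae) hU cT continuousOn_const hu
    have hvol : volDensity (g u) (E u) ≠ 0 :=
      mul_ne_zero (Real.sqrt_pos.2 (abs_pos.2 (hg.det_ne_zero u hu))).ne'
        (abs_pos.2 (hE.det_ne_zero u hu)).ne'
    exact (mul_eq_zero.1 h2).resolve_right hvol
  · intro hT0 K hK hKU δ hδ
    refine (h K hK hKU δ hδ).congr_deriv ?_
    refine setIntegral_eq_zero_of_forall_eq_zero fun u hu => ?_
    simp [hT0 u (hKU hu)]

end Variation

/-! ### Field equations with effective sources -/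

section FieldEquations

variable {U : Set Pt} {g : FrameMetric} {E : Coframe}

/-- The Euler-Lagrange equations of the gravitational action with a source: the functional
derivative of the gravitational part is `-(8πG)⁻¹` times the Einstein contraction. -/
theorem isStationary_gravAction_add_iff (hU : IsOpen U) (hE : IsAdaptedCoframe U E)
    (hg : IsDMetric U g) {Γ : ConnForms} (hΓ : ∀ α β μ, ContDiffOn ℝ 1 (fun u => Γ u α β μ) U)
    (hΓg : IsMetricCompatible U g Γ) {G : ℝ} (hG : 0 < G) (lam : ℝ) {S : Action} {T : MixedTensor}
    (hT : ∀ μ τ, ContinuousOn (fun u => T u μ τ) U) (hS : HasFunctionalDeriv U g E S T) :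
    IsStationary U E (fun K e => gravAction G lam g Γ K e + S K e) ↔
      ∀ u ∈ U, FormEquation G lam (g u) (E u) (curv Γ u) (sourceForm (g u) (E u) (T u)) := by
  have hC (u) (hu : u ∈ U) : IsAntisymm (g u) (curv Γ u) :=
    isAntisymm_curv hU hg.contDiffOn hg.symm hg.det_ne_zero hΓ hΓg hu
  have hgrav := hasFunctionalDeriv_action hU hE hg (continuousOn_curv hU hΓ) hC G lam
  have hc (μ τ) : ContinuousOn (fun u => (8 * Real.pi * G)⁻¹ *
      -einstein lam (g u) (E u) (curv Γ u) μ τ) U :=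
    continuousOn_const.mul (continuousOn_einstein
      (fun α β => (contDiffOn_inv hg.contDiffOn hg.det_ne_zero α β).continuousOn)
      (fun μ α => (contDiffOn_frame hE μ α).continuousOn) (continuousOn_curv hU hΓ) lam μ τ).neg
  have hpi : 8 * Real.pi * G ≠ 0 := by positivity
  refine (isStationary_iff hU hE hg (hgrav.add hE hg hS hc hT)
    fun μ τ => (hc μ τ).add (hT μ τ)).trans (forall₂_congr fun u hu => ?_)
  rw [← tensorEquation_iff_formEquation (hg.symm u hu) (hg.det_ne_zero u hu)
    (hE.det_ne_zero u hu) (hC u hu)]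
  refine forall₂_congr fun μ τ => ?_
  change _ ↔ einstein lam (g u) (E u) (curv Γ u) μ τ = _
  rw [mul_neg, neg_add_eq_zero, inv_mul_eq_iff_eq_mul₀ hpi]

theorem distSource_eq (G : ℝ) (g : FrameMetric) (E : Coframe) (Γ : ConnForms) (u : Pt)
    (μ τ : Fin 4) : distSource G g E Γ u μ τ = (8 * Real.pi * G)⁻¹ *
      -einstein 0 (g u) (E u) (distCurv Γ (distortion g E Γ) u) μ τ := by
  simp only [distSource, einstein, add_zero]

theorem continuousOn_distSource (hU : IsOpen U) (hE : IsAdaptedCoframe U E) (hg : IsDMetric U g)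
    {Γ : ConnForms} (hΓ : ∀ α β μ, ContDiffOn ℝ 1 (fun u => Γ u α β μ) U) (G : ℝ) (μ τ : Fin 4) :
    ContinuousOn (fun u => distSource G g E Γ u μ τ) U := by
  simp only [distSource_eq]
  exact continuousOn_const.mul (continuousOn_einstein
    (fun α β => (contDiffOn_inv hg.contDiffOn hg.det_ne_zero α β).continuousOn)
    (fun μ α => (contDiffOn_frame hE μ α).continuousOn) (continuousOn_distCurv hU hE hg hΓ) 0
    μ τ).neg

theorem hasFunctionalDeriv_distAction (hU : IsOpen U) (hE : IsAdaptedCoframe U E)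
    (hg : IsDMetric U g) {Γ : ConnForms} (hΓ : ∀ α β μ, ContDiffOn ℝ 1 (fun u => Γ u α β μ) U)
    (hΓg : IsMetricCompatible U g Γ) (G : ℝ) :
    HasFunctionalDeriv U g E (distAction G g Γ (distortion g E Γ)) (distSource G g E Γ) := by
  have h := hasFunctionalDeriv_action hU hE hg (continuousOn_distCurv hU hE hg hΓ)
    (fun u hu => isAntisymm_distCurv hU hE hg hΓ hΓg hu) G 0
  simp only [add_zero, ← distSource_eq] at h
  exact h

end FieldEquations

end NAnholonomic

end

open NAnholonomic in
theorem mainTheorem11 {Φ : Type*} (G lam : ℝ) (hG : 0 < G)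
    (U : Set NAnholonomic.Pt) (hU : IsOpen U)
    (E : NAnholonomic.Coframe) (hE : NAnholonomic.IsAdaptedCoframe U E)
    (g : NAnholonomic.FrameMetric) (hg : NAnholonomic.IsDMetric U g)
    (Γ : NAnholonomic.ConnForms) (hΓ : NAnholonomic.IsDConnection U Γ)
    (hΓg : NAnholonomic.IsMetricCompatible U g Γ) :
    -- the tensor field equations are the 3-form equations, for any source
    (∀ u ∈ U, ∀ T : Fin 4 → Fin 4 → ℝ,
      NAnholonomic.TensorEquation G lam (g u) (E u) (NAnholonomic.curv Γ u) T ↔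
        NAnholonomic.FormEquation G lam (g u) (E u) (NAnholonomic.curv Γ u)
          (NAnholonomic.sourceForm (g u) (E u) T)) ∧
    -- they are the Euler-Lagrange equations in the coframe, for any effective matter action
    (∀ (Seff : NAnholonomic.Action) (T : NAnholonomic.MixedTensor),
      (∀ μ τ, ContinuousOn (fun u => T u μ τ) U) →
      NAnholonomic.HasFunctionalDeriv U g E Seff T →
      (NAnholonomic.IsStationary U E
          (fun K e => NAnholonomic.gravAction G lam g Γ K e + Seff K e) ↔
        ∀ u ∈ U, NAnholonomic.FormEquation G lam (g u) (E u) (NAnholonomic.curv Γ u)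
          (NAnholonomic.sourceForm (g u) (E u) (T u)))) ∧
    -- curvature of `D` = Levi-Civita curvature - distortion, as 2-forms
    (∀ u ∈ U, ∀ τ γ,
      NAnholonomic.twoForm (NAnholonomic.curv Γ u) τ γ =
        NAnholonomic.twoForm (NAnholonomic.curv (NAnholonomic.leviCivita g E) u) τ γ -
        NAnholonomic.twoForm
          (NAnholonomic.distCurv Γ (NAnholonomic.distortion g E Γ) u) τ γ) ∧
    -- the distortion part of the action has the functional derivative `T_Z`
    NAnholonomic.HasFunctionalDeriv U g E
      (NAnholonomic.distAction G g Γ (NAnholonomic.distortion g E Γ))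
      (NAnholonomic.distSource G g E Γ) ∧
    -- matter fields `φ` with action `Sm`, and `Tm = δ Sm / δ e`
    (∀ (Sm : Set NAnholonomic.Pt → NAnholonomic.Coframe → NAnholonomic.ConnForms → Φ → ℝ) (φ : Φ)
      (Tm : NAnholonomic.MixedTensor),
      (∀ μ τ, ContinuousOn (fun u => Tm u μ τ) U) →
      NAnholonomic.HasFunctionalDeriv U g E (fun K e => Sm K e Γ φ) Tm →
      (NAnholonomic.IsStationary U E
          (fun K e => NAnholonomic.gravAction G lam g Γ K e +
            NAnholonomic.distAction G g Γ (NAnholonomic.distortion g E Γ) K e + Sm K e Γ φ) ↔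
        ∀ u ∈ U, NAnholonomic.FormEquation G lam (g u) (E u) (NAnholonomic.curv Γ u)
          (fun τ => NAnholonomic.sourceForm (g u) (E u) (Tm u) τ +
            NAnholonomic.sourceForm (g u) (E u) (NAnholonomic.distSource G g E Γ u) τ))) ∧
    -- with the source `𝒯_m + 𝒯_Z` they are the usual Einstein equations
    (∀ u ∈ U, ∀ Tm : Fin 4 → Fin 4 → ℝ,
      NAnholonomic.FormEquation G lam (g u) (E u) (NAnholonomic.curv Γ u)
          (fun τ => NAnholonomic.sourceForm (g u) (E u) Tm τ +
            NAnholonomic.sourceForm (g u) (E u) (NAnholonomic.distSource G g E Γ u) τ) ↔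
        NAnholonomic.TensorEquation G lam (g u) (E u)
          (NAnholonomic.curv (NAnholonomic.leviCivita g E) u) Tm) := by
  have hc := hΓ.contDiffOn
  have hC (u) (hu : u ∈ U) : IsAntisymm (g u) (curv Γ u) :=
    isAntisymm_curv hU hg.contDiffOn hg.symm hg.det_ne_zero hc hΓg hu
  have h1 (u) (hu : u ∈ U) (T : Fin 4 → Fin 4 → ℝ) :=
    tensorEquation_iff_formEquation (G := G) (lam := lam) (hg.symm u hu) (hg.det_ne_zero u hu)
      (hE.det_ne_zero u hu) (hC u hu) T
  have hdist := hasFunctionalDeriv_distAction hU hE hg hc hΓg G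
  have hdc := continuousOn_distSource hU hE hg hc G
  have hpi : 8 * Real.pi * G ≠ 0 := by positivity
  refine ⟨h1, fun Seff T hT hS => isStationary_gravAction_add_iff hU hE hg hc hΓg hG lam hT hS,
    fun u hu τ γ => ?_, hdist, fun Sm φ Tm hTm hSm => ?_, fun u hu Tm => ?_⟩
  · simp only [twoForm, curv_leviCivita hU hE hg hc hu, mul_add, add_smul, Finset.sum_add_distrib,
      add_sub_cancel_right]
  · have h2 := isStationary_gravAction_add_iff hU hE hg hc hΓg hG lam
      (T := fun u μ τ => Tm u μ τ + distSource G g E Γ u μ τ)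
      (fun μ τ => (hTm μ τ).add (hdc μ τ)) (hSm.add hE hg hdist hTm hdc)
    simp only [add_comm (Sm _ _ _ _), ← add_assoc] at h2
    simp only [← sourceForm_add]
    exact h2
  · have hLC : curv (leviCivita g E) u = fun α β μ ν =>
        curv Γ u α β μ ν + distCurv Γ (distortion g E Γ) u α β μ ν := by
      ext α β μ ν
      exact curv_leviCivita hU hE hg hc hu α β μ ν
    simp only [← sourceForm_add]
    rw [← h1 u hu, hLC]
    refine forall₂_congr fun μ τ => ?_
    change einstein lam (g u) (E u) _ μ τ = _ ↔ einstein lam (g u) (E u) _ μ τ = _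
    beta_reduce
    rw [einstein_add, distSource_eq, mul_add, mul_inv_cancel_left₀ hpi, ← sub_eq_add_neg,
      eq_sub_iff_add_eq]
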